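/- Let $K\subset\mathbb C$ be a closed regular octagon (the table). For $x\notin K$ let $v\in K$ be the point at which the right tangent line from $x$ touches $K$, i.e. the point such that every other point of $K$ lies strictly to the left of the line directed from $x$ to $v$; the outer billiard map is $Tx=2v-x$, and it is undefined at $x$ if there is no such $v$ (that is, if the right tangent line contains a side of $K$). A point $x\notin K$ is called finite if $T^nx$ is undefined for some $n\ge 0$, periodic if $T^nx=x$ for some $n\ge1$ (the least such $n$ is its period), and aperiodic if it is neither finite nor periodic. A component is a connected component of the set of those points outside $K$ that are not finite. Then there is an aperiodic point $C\notin K$: all the iterates $T^nC$, $n\ge0$, are defined, $C$ is not periodic, and its orbit $\{T^nC: n\ge 0\}$ is an infinite set. Moreover, $C$ can be chosen as the limit of a self-similar sequence of periodic octagonal components. Namely, there are components $U_0,U_1,U_2,\dots$, each of them the interior of a regular octagon, with centres $c_0,c_1,c_2,\dots$, and positive integers $p_0,p_1,p_2,\dots$ such that * all points of $U_n$ are periodic, and all of them, except possibly the centre $c_n$, have period $p_n$; * $p_n\to\infty$ as $n\to\infty$; * there is $a\in\mathbb C$ with $0<|a|<1$ such that the similarity $S(z)=C+a(z-C)$ satisfies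 $S(c_n)=c_{n+3}$ and $S(\overline{U_n})=\overline{U_{n+3}}$ for all $n\ge0$; * $c_n\to C$ as $n\to\infty$; * for every $k\ge0$ the point $C$ lies in the interior of the triangle $c_{3k}c_{3k+1}c_{3k+2}$, and this interior contains the closed triangle $c_{3k+3}c_{3k+4}c_{3k+5}$. -/

import Mathlib

open Filter Topology

/-- The closed regular octagon in the plane `ℂ` with centre `o`, one of whose vertices is `o + w`. -/
noncomputable def regularOctagon (o w : ℂ) : Set ℂ :=
  convexHull ℝ (Set.range fun k : Fin 8 =>
    o + w * Complex.exp (2 * Real.pi * Complex.I * ((k : ℕ) : ℂ) / 8))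

/-- The right tangent line from the point `x`, outside of the table `K`, touches `K` at the single
point `v`: every other point of `K` lies strictly to the left of the line directed from `x`
to `v`. -/
def IsRightTangency (K : Set ℂ) (x v : ℂ) : Prop :=
  x ∉ K ∧ v ∈ K ∧ ∀ y ∈ K, y ≠ v → 0 < (starRingEnd ℂ (v - x) * (y - x)).im

/-- The point of right tangency is unique when it exists. -/
theorem IsRightTangency.unique {K : Set ℂ} {x v v' : ℂ}
    (h : IsRightTangency K x v) (h' : IsRightTangency K x v') : v = v' := by
  by_contra hne
  have h1 := h.2.2 v' h'.2.1 (Ne.symm hne)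
  have h2 := h'.2.2 v h.2.1 hne
  simp only [map_sub, Complex.mul_im, Complex.sub_re, Complex.sub_im, Complex.conj_re,
    Complex.conj_im] at h1 h2
  linarith

open Classical in
/-- The outer billiard map about the table `K`: a point `x` outside of `K` is reflected in the
point of right tangency; the value is `none` where this point is not defined. -/
noncomputable def outerBilliard (K : Set ℂ) (x : ℂ) : Option ℂ :=
  if h : ∃ v, IsRightTangency K x v then some (2 * h.choose - x) else none

theorem outerBilliard_eq_some_iff {K : Set ℂ} {x y : ℂ} :
    outerBilliard K x = some y ↔ ∃ v, IsRightTangency K x v ∧ y = 2 * v - x := by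
  unfold outerBilliard
  split_ifs with h
  · constructor
    · intro hy
      exact ⟨h.choose, h.choose_spec, (Option.some.inj hy).symm⟩
    · rintro ⟨v, hv, rfl⟩
      rw [h.choose_spec.unique hv]
  · constructor
    · intro hy
      cases hy
    · rintro ⟨v, hv, -⟩
      exact absurd ⟨v, hv⟩ h

/-- The iterate `T ^ n x` of the outer billiard map, `none` if it is not defined. -/
noncomputable def billiardIter (K : Set ℂ) (n : ℕ) (x : ℂ) : Option ℂ :=
  (fun y : Option ℂ => y.bind (outerBilliard K))^[n] (some x)

/-- The orbit of `x`: all the points `T ^ n x`, `n ≥ 0`, that are defined. -/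
def billiardOrbit (K : Set ℂ) (x : ℂ) : Set ℂ :=
  {y | ∃ n, billiardIter K n x = some y}

/-- The points outside of the table with a finite orbit: some iterate is not defined. -/
def finitePoints (K : Set ℂ) : Set ℂ :=
  {x | x ∉ K ∧ ∃ n, billiardIter K n x = none}

/-- `x` is periodic and `p` is its period, the least `n ≥ 1` with `T ^ n x = x`. -/
def HasPeriod (K : Set ℂ) (x : ℂ) (p : ℕ) : Prop :=
  IsLeast {n : ℕ | 0 < n ∧ billiardIter K n x = some x} p

/-- `x` is a periodic point of the outer billiard map. -/
def IsPeriodicPoint (K : Set ℂ) (x : ℂ) : Prop :=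
  ∃ p, HasPeriod K x p

/-- `x` is an aperiodic point: all the iterates `T ^ n x` are defined and `x` is not periodic. -/
def IsAperiodicPoint (K : Set ℂ) (x : ℂ) : Prop :=
  x ∉ K ∧ x ∉ finitePoints K ∧ ¬ IsPeriodicPoint K x

/-- `U` is one of the components into which the points with finite orbit divide the exterior of
the table. -/
def IsBilliardComponent (K U : Set ℂ) : Prop :=
  ∃ x ∈ Kᶜ \ finitePoints K, U = connectedComponentIn (Kᶜ \ finitePoints K) x

/-- The (closed) triangle with vertices `x`, `y`, `z`. -/
def triangle (x y z : ℂ) : Set ℂ := convexHull ℝ {x, y, z}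

/-!
The table is normalized to an octagon with centre `0` and side `2`.

**The induced map.** Since the outer billiard map `T` commutes with the rotation through `π / 4`,
it can be followed on the wedge of the points whose point of right tangency is one fixed vertex,
rotating each image back into the wedge. On a triangle at that vertex the resulting first-return
map has three pieces `A`, `B`, `C`, each of which is the set of all points that follow a certain
word of rotations (`polygon_baseCylinder`).

**Self-similarity.** Let `S` be the contraction by `3 - 2√2` towards the vertex of the triangle.
It maps the triangle onto the piece `C`, and it conjugates the induced map to the first-return map
to that piece; the words of the returns define a substitution on the letters `A`, `B`, `C`. Both
facts are equalities of explicit polygons with sides in the eight directions of the octagon and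
with coefficients in `ℤ[√2]`, so they are decided by exact computation
(`polygon_cylinderSides_subst`, `wordIso_subst_t`). Hence `S` maps the set of the points that
follow a word onto the set of those that follow the substituted word (`shrinkMap_mem_cylinder`).

**Components.** A connected set of points all of whose iterates are defined cannot cross a
discontinuity, so if it meets the set of the points that follow some word, it lies in that set
(`subset_cylinder`). Therefore an open octagon that returns to itself along a word, and is exactly
the set of the points following some longer word, is a component, and all of its points are
periodic. On it an iterate of `T` is a translation or a point reflection. When it fixes a point
other than the centre, it is the identity, so all these points have the same period
(`exists_hasPeriod`). Such octagons are mapped to such octagons by `S` and by the induced map.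

**The limit point.** All words of the substitution start with `C A`, so `S` followed by the steps
`C` and `A` is a similarity of the whole triangle that preserves the class of these octagons. It
turns by three eighths, and its eighth power is a homothety. Its fixed point, `limitPoint`, lies
in the piece `B`; it follows words of arbitrary length, so all its iterates are defined. The
sequence of octagons consists of the images under this homothety of three octagons around the
fixed point. If the fixed point were periodic, a neighbourhood of it would consist of periodic
points and lie in a single component, but the octagons that accumulate at the fixed point do not
contain it. Finally, the periods tend to infinity: near the limit point `T ^ (2 m)` is a
translation, and not the identity.
-/

/-! ### The outer billiard map of an arbitrary table -/

/-- The affine map `z ↦ o + b z` of the plane. -/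
noncomputable def similarity (o b z : ℂ) : ℂ := o + b * z

theorem similarity_injective {o b : ℂ} (hb : b ≠ 0) : Function.Injective (similarity o b) := by
  intro x y h
  simpa [similarity, hb] using h

theorem isRightTangency_similarity {K : Set ℂ} {o b : ℂ} (hb : b ≠ 0) {x v : ℂ} :
    IsRightTangency (similarity o b '' K) (similarity o b x) (similarity o b v) ↔
      IsRightTangency K x v := by
  have hinj := similarity_injective (o := o) hb
  have hpos : 0 < Complex.normSq b := Complex.normSq_pos.2 hb
  have key : ∀ y, (starRingEnd ℂ (similarity o b v - similarity o b x) *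
      (similarity o b y - similarity o b x)).im =
      Complex.normSq b * (starRingEnd ℂ (v - x) * (y - x)).im := by
    intro y
    simp only [similarity, Complex.normSq_apply, map_sub, map_add, map_mul, Complex.mul_im,
      Complex.sub_re, Complex.sub_im, Complex.add_re, Complex.add_im, Complex.conj_re,
      Complex.conj_im, Complex.mul_re]
    ring
  unfold IsRightTangency
  rw [hinj.mem_set_image, hinj.mem_set_image, Set.forall_mem_image]
  simp only [key, hinj.ne_iff, mul_pos_iff_of_pos_left hpos]

theorem similarity_two_mul_sub (o b v x : ℂ) :
    2 * similarity o b v - similarity o b x = similarity o b (2 * v - x) := by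
  unfold similarity; ring

theorem outerBilliard_similarity {K : Set ℂ} {o b : ℂ} (hb : b ≠ 0) (x : ℂ) :
    outerBilliard (similarity o b '' K) (similarity o b x) =
      (outerBilliard K x).map (similarity o b) := by
  ext y
  rw [outerBilliard_eq_some_iff, Option.map_eq_some_iff]
  constructor
  · rintro ⟨v', hv', rfl⟩
    obtain ⟨v, -, rfl⟩ := hv'.2.1
    rw [isRightTangency_similarity hb] at hv'
    exact ⟨2 * v - x, outerBilliard_eq_some_iff.2 ⟨v, hv', rfl⟩,
      (similarity_two_mul_sub o b v x).symm⟩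
  · rintro ⟨z, hz, rfl⟩
    obtain ⟨v, hv, rfl⟩ := outerBilliard_eq_some_iff.1 hz
    exact ⟨similarity o b v, (isRightTangency_similarity hb).2 hv,
      (similarity_two_mul_sub o b v x).symm⟩

theorem billiardIter_zero (K : Set ℂ) (x : ℂ) : billiardIter K 0 x = some x := rfl

theorem billiardIter_succ (K : Set ℂ) (n : ℕ) (x : ℂ) :
    billiardIter K (n + 1) x = (billiardIter K n x).bind (outerBilliard K) := by
  unfold billiardIter
  rw [Function.iterate_succ_apply']

theorem billiardIter_add {K : Set ℂ} {m : ℕ} {x y : ℂ} (h : billiardIter K m x = some y) (n : ℕ) :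
    billiardIter K (m + n) x = billiardIter K n y := by
  induction n with
  | zero => simpa [billiardIter_zero] using h
  | succ n ih => rw [← add_assoc, billiardIter_succ, billiardIter_succ, ih]

theorem billiardIter_one (K : Set ℂ) (x : ℂ) : billiardIter K 1 x = outerBilliard K x := rfl

theorem billiardIter_of_le {K : Set ℂ} {m n : ℕ} {x : ℂ} (h : billiardIter K n x ≠ none)
    (hmn : m ≤ n) : billiardIter K m x ≠ none := by
  intro hm
  obtain ⟨k, rfl⟩ := Nat.exists_eq_add_of_le hmn
  apply h
  clear h hmn
  induction k with
  | zero => exact hm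
  | succ k ih => rw [← add_assoc, billiardIter_succ, ih]; rfl

theorem billiardIter_similarity {K : Set ℂ} {o b : ℂ} (hb : b ≠ 0) (n : ℕ) (x : ℂ) :
    billiardIter (similarity o b '' K) n (similarity o b x) =
      (billiardIter K n x).map (similarity o b) := by
  induction n with
  | zero => rfl
  | succ n ih =>
    rw [billiardIter_succ, billiardIter_succ, ih]
    cases billiardIter K n x with
    | none => rfl
    | some y => exact outerBilliard_similarity hb y

theorem billiardIter_similarity_eq_some {K : Set ℂ} {o b : ℂ} (hb : b ≠ 0) {n : ℕ} {x y : ℂ} :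
    billiardIter (similarity o b '' K) n (similarity o b x) = some (similarity o b y) ↔
      billiardIter K n x = some y := by
  rw [billiardIter_similarity hb, Option.map_eq_some_iff]
  constructor
  · rintro ⟨z, hz, h⟩
    rwa [similarity_injective hb h] at hz
  · exact fun h => ⟨y, h, rfl⟩

/-- The points outside of the table all of whose iterates are defined. -/
def nonfinitePoints (K : Set ℂ) : Set ℂ := Kᶜ \ finitePoints K

theorem mem_nonfinitePoints {K : Set ℂ} {x : ℂ} :
    x ∈ nonfinitePoints K ↔ x ∉ K ∧ ∀ n, billiardIter K n x ≠ none := by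
  simp only [nonfinitePoints, finitePoints, Set.mem_sdiff, Set.mem_compl_iff, Set.mem_ofPred_eq,
    not_and, not_exists]
  tauto

theorem mem_nonfinitePoints_of_periodic {K : Set ℂ} {x : ℂ} (hx : x ∉ K) {n : ℕ} (hn : 0 < n)
    (h : billiardIter K n x = some x) : x ∈ nonfinitePoints K := by
  refine mem_nonfinitePoints.2 ⟨hx, fun m => ?_⟩
  have hmul : ∀ j, billiardIter K (j * n) x = some x := by
    intro j
    induction j with
    | zero => rw [zero_mul, billiardIter_zero]
    | succ j ih => rw [add_mul, one_mul, billiardIter_add ih, h]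
  refine billiardIter_of_le (n := m * n) ?_ (Nat.le_mul_of_pos_right m hn)
  rw [hmul]
  exact Option.some_ne_none x

theorem similarity_mem_nonfinitePoints {K : Set ℂ} {o b : ℂ} (hb : b ≠ 0) {x : ℂ} :
    similarity o b x ∈ nonfinitePoints (similarity o b '' K) ↔ x ∈ nonfinitePoints K := by
  simp only [mem_nonfinitePoints, (similarity_injective (o := o) hb).mem_set_image,
    billiardIter_similarity hb, ne_eq, Option.map_eq_none_iff]

theorem hasPeriod_similarity {K : Set ℂ} {o b : ℂ} (hb : b ≠ 0) {x : ℂ} {p : ℕ} :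
    HasPeriod (similarity o b '' K) (similarity o b x) p ↔ HasPeriod K x p := by
  simp only [HasPeriod, billiardIter_similarity_eq_some hb]

theorem isPeriodicPoint_similarity {K : Set ℂ} {o b : ℂ} (hb : b ≠ 0) {x : ℂ} :
    IsPeriodicPoint (similarity o b '' K) (similarity o b x) ↔ IsPeriodicPoint K x := by
  simp only [IsPeriodicPoint, hasPeriod_similarity hb]

theorem isPeriodicPoint_iff {K : Set ℂ} {x : ℂ} :
    IsPeriodicPoint K x ↔ ∃ n, 0 < n ∧ billiardIter K n x = some x := by
  constructor
  · rintro ⟨p, hp, -⟩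
    exact ⟨p, hp⟩
  · rintro ⟨n, hn⟩
    classical
    exact ⟨_, Nat.find_spec ⟨n, hn⟩, fun m hm => Nat.find_min' ⟨n, hn⟩ hm⟩

/-- The similarity `z ↦ o + b z` as a homeomorphism. -/
noncomputable def similarityHomeomorph (o : ℂ) {b : ℂ} (hb : b ≠ 0) : ℂ ≃ₜ ℂ :=
  (Homeomorph.mulLeft₀ b hb).trans (Homeomorph.addLeft o)

theorem coe_similarityHomeomorph (o : ℂ) {b : ℂ} (hb : b ≠ 0) :
    ⇑(similarityHomeomorph o hb) = similarity o b := rfl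

theorem nonfinitePoints_similarity {K : Set ℂ} {o b : ℂ} (hb : b ≠ 0) :
    nonfinitePoints (similarity o b '' K) = similarity o b '' nonfinitePoints K := by
  ext z
  obtain ⟨x, rfl⟩ := (similarityHomeomorph o hb).surjective z
  rw [coe_similarityHomeomorph, similarity_mem_nonfinitePoints hb,
    (similarity_injective hb).mem_set_image]

theorem isBilliardComponent_similarity {K U : Set ℂ} {o b : ℂ} (hb : b ≠ 0)
    (h : IsBilliardComponent K U) :
    IsBilliardComponent (similarity o b '' K) (similarity o b '' U) := by
  obtain ⟨x, hx, rfl⟩ := h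
  refine ⟨similarity o b x, (similarity_mem_nonfinitePoints hb).2 hx, ?_⟩
  have := (similarityHomeomorph o hb).image_connectedComponentIn (s := nonfinitePoints K) hx
  rw [coe_similarityHomeomorph] at this
  rw [← nonfinitePoints, ← nonfinitePoints, this, nonfinitePoints_similarity hb]

theorem isAperiodicPoint_iff {K : Set ℂ} {x : ℂ} :
    IsAperiodicPoint K x ↔ x ∈ nonfinitePoints K ∧ ¬ IsPeriodicPoint K x := by
  simp only [IsAperiodicPoint, nonfinitePoints, Set.mem_sdiff, Set.mem_compl_iff, and_assoc]

theorem isAperiodicPoint_similarity {K : Set ℂ} {o b : ℂ} (hb : b ≠ 0) {x : ℂ} :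
    IsAperiodicPoint (similarity o b '' K) (similarity o b x) ↔ IsAperiodicPoint K x := by
  simp only [isAperiodicPoint_iff, similarity_mem_nonfinitePoints hb,
    isPeriodicPoint_similarity hb]

theorem outerBilliard_notMem {K : Set ℂ} {x y : ℂ} (h : outerBilliard K x = some y) : y ∉ K := by
  obtain ⟨v, hv, rfl⟩ := outerBilliard_eq_some_iff.1 h
  intro hy
  have hne : 2 * v - x ≠ v := by
    intro h'
    apply hv.1
    rw [show x = v by linear_combination -h']
    exact hv.2.1
  have := hv.2.2 _ hy hne
  simp only [map_sub, Complex.mul_im, Complex.sub_re, Complex.sub_im, Complex.conj_re,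
    Complex.conj_im, Complex.mul_re, Complex.re_ofNat, Complex.im_ofNat] at this
  linarith

theorem billiardIter_mem_nonfinitePoints {K : Set ℂ} {x y : ℂ} (hx : x ∈ nonfinitePoints K) {n : ℕ}
    (h : billiardIter K n x = some y) : y ∈ nonfinitePoints K := by
  rw [mem_nonfinitePoints] at hx ⊢
  refine ⟨?_, fun m => billiardIter_add h m ▸ hx.2 _⟩
  cases n with
  | zero =>
    cases h
    exact hx.1
  | succ n =>
    rw [billiardIter_succ, Option.bind_eq_some_iff] at h
    obtain ⟨z, -, hz⟩ := h
    exact outerBilliard_notMem hz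

/-- The outer billiard map is injective, since a point is also determined by its image and the
point of left tangency seen from there. -/
theorem outerBilliard_injective {K : Set ℂ} {x x' y : ℂ} (h : outerBilliard K x = some y)
    (h' : outerBilliard K x' = some y) : x = x' := by
  obtain ⟨v, hv, rfl⟩ := outerBilliard_eq_some_iff.1 h
  obtain ⟨v', hv', e⟩ := outerBilliard_eq_some_iff.1 h'
  have hx : x = 2 * v - 2 * v' + x' := by linear_combination -e
  by_cases hvv : v' = v
  · rw [hx, hvv]; ring
  exfalso
  have h1 := hv.2.2 v' hv'.2.1 hvv
  have h2 := hv'.2.2 v hv.2.1 (Ne.symm hvv)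
  rw [hx] at h1
  simp only [map_sub, map_add, Complex.mul_im, Complex.sub_re, Complex.sub_im, Complex.conj_re,
    Complex.conj_im, Complex.mul_re, Complex.re_ofNat, Complex.im_ofNat, Complex.add_re,
    Complex.add_im, map_mul] at h1 h2
  linarith

theorem billiardIter_injective {K : Set ℂ} {n : ℕ} {x x' y : ℂ} (h : billiardIter K n x = some y)
    (h' : billiardIter K n x' = some y) : x = x' := by
  induction n generalizing y with
  | zero =>
    rw [billiardIter_zero, Option.some_inj] at h h'
    rw [h, h']
  | succ n ih =>
    rw [billiardIter_succ, Option.bind_eq_some_iff] at h h'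
    obtain ⟨z, hz, hzy⟩ := h
    obtain ⟨z', hz', hzy'⟩ := h'
    rw [outerBilliard_injective hzy' hzy] at hz'
    exact ih hz hz'

theorem IsAperiodicPoint.infinite_billiardOrbit {K : Set ℂ} {x : ℂ} (h : IsAperiodicPoint K x) :
    (billiardOrbit K x).Infinite := by
  rw [isAperiodicPoint_iff, mem_nonfinitePoints] at h
  obtain ⟨⟨-, hdef⟩, hper⟩ := h
  choose f hf using fun n => Option.ne_none_iff_exists'.1 (hdef n)
  have hlt : ∀ m n, m < n → f m ≠ f n := by
    intro m n hmn e
    obtain ⟨k, rfl⟩ := Nat.exists_eq_add_of_le hmn.le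
    refine hper (isPeriodicPoint_iff.2 ⟨k, by omega, ?_⟩)
    have hk : billiardIter K m (f k) = some (f m) := by
      rw [e, ← hf (m + k), add_comm, billiardIter_add (hf k)]
    rw [hf k, billiardIter_injective hk (hf m)]
  have hinj : Function.Injective f := by
    intro m n e
    rcases lt_trichotomy m n with hmn | hmn | hmn
    · exact absurd e (hlt m n hmn)
    · exact hmn
    · exact absurd e.symm (hlt n m hmn)
  exact (Set.infinite_range_of_injective hinj).mono (Set.range_subset_iff.2 fun n => ⟨n, hf n⟩)

theorem regularOctagon_similarity (o b c v : ℂ) :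
    similarity o b '' regularOctagon c v = regularOctagon (o + b * c) (b * v) := by
  let f : ℂ →ᵃ[ℝ] ℂ := AffineMap.const ℝ ℂ o + ((LinearMap.mulLeft ℝ b).toAffineMap)
  have hf : (f : ℂ → ℂ) = similarity o b := rfl
  unfold regularOctagon
  rw [← hf, AffineMap.image_convexHull, ← Set.range_comp]
  congr 2
  ext k
  simp only [hf, Function.comp, similarity]
  ring

theorem triangle_similarity (o b x y z : ℂ) :
    similarity o b '' triangle x y z =
      triangle (similarity o b x) (similarity o b y) (similarity o b z) := by
  let f : ℂ →ᵃ[ℝ] ℂ := AffineMap.const ℝ ℂ o + ((LinearMap.mulLeft ℝ b).toAffineMap)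
  have hf : (f : ℂ → ℂ) = similarity o b := rfl
  unfold triangle
  rw [← hf, AffineMap.image_convexHull, Set.image_insert_eq, Set.image_pair]

/-! ### The regular octagon -/

/-- The primitive eighth root of unity `exp (π i / 4)`. -/
noncomputable def zeta : ℂ := ⟨√2 / 2, √2 / 2⟩

theorem sqrt_two_mul_self : (√2 : ℝ) * √2 = 2 := Real.mul_self_sqrt (by norm_num)

theorem zeta_sq : zeta ^ 2 = Complex.I := by
  rw [sq]
  apply Complex.ext
  · simp [zeta]
  · simp only [zeta, Complex.mul_im, Complex.I_im]
    linear_combination (1 / 2 : ℝ) * sqrt_two_mul_self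

theorem zeta_pow_four : zeta ^ 4 = -1 := by
  rw [show (4 : ℕ) = 2 * 2 from rfl, pow_mul, zeta_sq, Complex.I_sq]

theorem zeta_pow_three : zeta ^ 3 = Complex.I * zeta := by
  rw [← zeta_sq]; ring

theorem zeta_pow_five : zeta ^ 5 = -zeta := by
  linear_combination zeta * zeta_pow_four

theorem zeta_pow_six : zeta ^ 6 = -Complex.I := by
  rw [← zeta_sq]; linear_combination zeta ^ 2 * zeta_pow_four

theorem zeta_pow_seven : zeta ^ 7 = -(Complex.I * zeta) := by
  rw [← zeta_pow_three]; linear_combination zeta ^ 3 * zeta_pow_four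

theorem zeta_pow_eight : zeta ^ 8 = 1 := by
  rw [show (8 : ℕ) = 4 * 2 from rfl, pow_mul, zeta_pow_four]; norm_num

theorem zeta_ne_zero : zeta ≠ 0 := by
  intro h
  have := zeta_pow_eight
  rw [h] at this
  norm_num at this

theorem zeta_pow_mod (n : ℕ) : zeta ^ (n % 8) = zeta ^ n := by
  conv_rhs => rw [← Nat.div_add_mod n 8, pow_add, pow_mul, zeta_pow_eight, one_pow, one_mul]

theorem zeta_eq_exp : zeta = Complex.exp (2 * Real.pi * Complex.I / 8) := by
  rw [show (2 * Real.pi * Complex.I / 8 : ℂ) = ((Real.pi / 4 : ℝ) : ℂ) * Complex.I by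
    push_cast; ring]
  rw [Complex.exp_mul_I, ← Complex.ofReal_cos, ← Complex.ofReal_sin, Real.cos_pi_div_four,
    Real.sin_pi_div_four]
  apply Complex.ext <;> simp [zeta]

theorem zeta_re_mul (z : ℂ) : (z * zeta).re = √2 / 2 * (z.re - z.im) := by
  simp only [zeta, Complex.mul_re]; ring

/-- A vertex of the octagon with centre `0` and side `2`, whose sides are parallel to the
directions `zeta ^ k`. -/
noncomputable def apex : ℂ := ⟨-1, 1 + √2⟩

theorem apex_ne_zero : apex ≠ 0 := by
  intro h
  have := congrArg Complex.re h
  simp [apex] at this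

/-- The octagon with vertices `zeta ^ k * apex`. -/
noncomputable def table : Set ℂ := regularOctagon 0 apex

theorem regularOctagon_eq (c v : ℂ) :
    regularOctagon c v = convexHull ℝ (Set.range fun k : Fin 8 => c + v * zeta ^ (k : ℕ)) := by
  unfold regularOctagon
  congr 2
  ext k
  rw [zeta_eq_exp, ← Complex.exp_nat_mul]
  congr 3
  ring

theorem vertex_mem_table (k : ℕ) : apex * zeta ^ k ∈ table := by
  rw [table, regularOctagon_eq]
  apply subset_convexHull
  exact ⟨⟨k % 8, Nat.mod_lt _ (by norm_num)⟩, by simp [zeta_pow_mod]⟩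

/-- The open octagon with centre `c` and `τ` times as large as `table`. -/
def openOctagon (c : ℂ) (τ : ℝ) : Set ℂ :=
  {z | ∀ k : ℕ, 2 * ((z - c) * zeta ^ k).re < 2 * τ * (1 + √2)}

theorem sqrt_two_bounds : (1.41421 : ℝ) < √2 ∧ √2 < (1.41422 : ℝ) := by
  constructor
  · exact Real.lt_sqrt_of_sq_lt (by norm_num)
  · rw [Real.sqrt_lt' (by norm_num)]; norm_num

theorem apex_mul_re_le (k : ℕ) : (apex * zeta ^ k).re ≤ 1 + √2 := by
  have h1 := sqrt_two_bounds
  have h2 := sqrt_two_mul_self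
  rw [← zeta_pow_mod]
  have hk : k % 8 < 8 := Nat.mod_lt _ (by norm_num)
  interval_cases k % 8 <;>
  simp only [pow_zero, pow_one, zeta_sq, zeta_pow_three, zeta_pow_four, zeta_pow_five,
    zeta_pow_six, zeta_pow_seven] <;>
  simp [zeta, apex] <;>
  nlinarith

theorem mem_table_iff {z : ℂ} : z ∈ table ↔ ∀ k : ℕ, (z * zeta ^ k).re ≤ 1 + √2 := by
  constructor
  · intro hz k
    rw [table, regularOctagon_eq] at hz
    have hconv : Convex ℝ {w : ℂ | (w * zeta ^ k).re ≤ 1 + √2} := by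
      have : IsLinearMap ℝ fun w : ℂ => (w * zeta ^ k).re :=
        ⟨fun x y => by simp [add_mul], fun a x => by simp [mul_assoc]⟩
      exact convex_halfSpace_le this _
    refine convexHull_min ?_ hconv hz
    rintro _ ⟨j, rfl⟩
    have := apex_mul_re_le (j + k)
    rwa [pow_add, ← mul_assoc, ← zero_add (apex * zeta ^ (j : ℕ))] at this
  · intro h
    obtain ⟨k, -, hk⟩ := (Finset.range 8).exists_max_image (fun k => (z * zeta ^ k).re) ⟨0, by simp⟩
    have hmax : ∀ j : ℕ, (z * zeta ^ j).re ≤ (z * zeta ^ k).re := by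
      intro j
      have := hk (j % 8) (Finset.mem_range.2 (Nat.mod_lt _ (by norm_num)))
      simpa only [zeta_pow_mod] using this
    -- `u` lies in the sector spanned by the two vertices of the side in the direction of `1`
    set u := z * zeta ^ k with hu
    have hz : z = u * zeta ^ (7 * k) := by
      rw [hu, mul_assoc, ← pow_add, show k + 7 * k = 8 * k by ring, pow_mul, zeta_pow_eight,
        one_pow, mul_one]
    have h1 : √2 / 2 * (u.re - u.im) ≤ u.re := by
      have := hmax (k + 1)
      rwa [pow_succ, ← mul_assoc, ← hu, zeta_re_mul] at this
    have h2 : √2 / 2 * (u.re + u.im) ≤ u.re := by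
      have := hmax (k + 7)
      rw [pow_add, ← mul_assoc, ← hu] at this
      convert this using 1
      rw [zeta_pow_seven]
      simp only [zeta, Complex.mul_re, Complex.neg_re, Complex.neg_im, Complex.I_re, Complex.I_im,
        Complex.mul_im]
      ring
    have h3 : u.re ≤ 1 + √2 := h k
    have hb := sqrt_two_bounds
    have hs := sqrt_two_mul_self
    have h1' : -u.im ≤ (√2 - 1) * u.re := by nlinarith
    have h2' : u.im ≤ (√2 - 1) * u.re := by nlinarith
    have h0 : 0 ≤ u.re := by nlinarith
    have hconv : Convex ℝ table := convex_convexHull ℝ _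
    have hv : ∀ j, apex * zeta ^ j ∈ table := vertex_mem_table
    have hzero : (0 : ℂ) ∈ table := by
      have := hconv (hv 0) (hv 4) (show (0 : ℝ) ≤ 1 / 2 by norm_num)
        (show (0 : ℝ) ≤ 1 / 2 by norm_num) (by norm_num)
      simpa [zeta_pow_four] using this
    have hα : 0 ≤ ((√2 - 1) * u.re + u.im) / 2 := by linarith
    have hβ : 0 ≤ ((√2 - 1) * u.re - u.im) / 2 := by linarith
    have hαβ : ((√2 - 1) * u.re + u.im) / 2 + ((√2 - 1) * u.re - u.im) / 2 ≤ 1 := by nlinarith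
    have hcomb : ∀ x ∈ table, ∀ y ∈ table, ∀ a b : ℝ, 0 ≤ a → 0 ≤ b → a + b ≤ 1 →
        (a : ℂ) * x + b * y ∈ table := by
      intro x hx y hy a b ha hb hab
      have := hconv.sum_mem (t := Finset.univ) (w := ![a, b, 1 - a - b]) (z := ![x, y, 0])
        (by intro i _; fin_cases i <;> simp <;> linarith)
        (by simp [Fin.sum_univ_three])
        (by intro i _; fin_cases i <;> simp [hx, hy, hzero])
      simpa [Fin.sum_univ_three] using this
    have := hcomb _ (hv (6 + 7 * k)) _ (hv (5 + 7 * k)) _ _ hα hβ hαβ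
    convert this using 1
    rw [pow_add, pow_add, hz]
    rw [show ∀ a b c : ℂ, a * (apex * (zeta ^ 6 * c)) + b * (apex * (zeta ^ 5 * c)) =
      (a * (apex * zeta ^ 6) + b * (apex * zeta ^ 5)) * c by intros; ring]
    congr 1
    rw [zeta_pow_six, zeta_pow_five]
    apply Complex.ext
    · simp [apex, zeta]
      linear_combination (-(√2 / 4 + 3 / 4) * u.re + 1 / 4 * u.im) * hs
    · simp [apex, zeta]
      linear_combination (-1 / 4 * u.im + (√2 / 4 - 1 / 4) * u.re) * hs

theorem similarity_zero_rotation_table (k : ℕ) : similarity 0 (zeta ^ k) '' table = table := by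
  have key : ∀ (k : ℕ) (z : ℂ), z ∈ table → similarity 0 (zeta ^ k) z ∈ table := by
    intro k z hz
    rw [mem_table_iff] at hz ⊢
    intro j
    have := hz (k + j)
    rwa [pow_add, ← mul_assoc, mul_comm z, ← zero_add (zeta ^ k * z)] at this
  apply Set.Subset.antisymm
  · rintro _ ⟨z, hz, rfl⟩
    exact key k z hz
  · intro z hz
    refine ⟨_, key (7 * k) z hz, ?_⟩
    simp only [similarity, zero_add, ← mul_assoc, ← pow_add]
    rw [show k + 7 * k = 8 * k by ring, pow_mul, zeta_pow_eight, one_pow, one_mul]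

theorem openOctagon_mem_smul_iff {c z : ℂ} {τ : ℝ} {m : ℕ} {t : ℂ} :
    zeta ^ m * z + t ∈ openOctagon (zeta ^ m * c + t) τ ↔ z ∈ openOctagon c τ := by
  have e : ∀ k : ℕ, (zeta ^ m * z + t - (zeta ^ m * c + t)) * zeta ^ k =
      (z - c) * zeta ^ (m + k) := by
    intro k; rw [pow_add]; ring
  simp only [openOctagon, Set.mem_ofPred_eq, e]
  constructor
  · intro h k
    have := h (7 * m + k)
    rwa [show m + (7 * m + k) = 8 * m + k by ring, pow_add, pow_mul, zeta_pow_eight, one_pow,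
      one_mul] at this
  · exact fun h k => h _

theorem interior_table : interior table = openOctagon 0 1 := by
  apply Set.Subset.antisymm
  · intro z hz k
    -- moving from `z` a little in the direction conjugate to `zeta ^ k` does not leave the table
    have hlim : Tendsto (fun ε : ℝ => z + (ε : ℂ) * zeta ^ (7 * k)) (𝓝[>] 0) (𝓝 z) := by
      have : ContinuousAt (fun ε : ℝ => z + (ε : ℂ) * zeta ^ (7 * k)) 0 := by fun_prop
      simpa [ContinuousAt] using this.mono_left nhdsWithin_le_nhds
    have hev : ∀ᶠ ε : ℝ in 𝓝[>] 0, z + (ε : ℂ) * zeta ^ (7 * k) ∈ table :=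
      hlim (mem_interior_iff_mem_nhds.1 hz)
    obtain ⟨ε, hε, hpos⟩ := (hev.and self_mem_nhdsWithin).exists
    have h1 := mem_table_iff.1 hε k
    rw [add_mul, mul_assoc, ← pow_add, show 7 * k + k = 8 * k by ring, pow_mul, zeta_pow_eight,
      one_pow, mul_one, Complex.add_re, Complex.ofReal_re] at h1
    have hpos' : 0 < ε := hpos
    rw [sub_zero]
    linarith
  · have hsub : openOctagon 0 1 ⊆ table := by
      intro z hz
      rw [mem_table_iff]
      intro k
      have := hz k
      rw [sub_zero] at this
      linarith
    have hopen : IsOpen (openOctagon 0 1) := by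
      have : openOctagon 0 1 = ⋂ k ∈ Finset.range 8,
          {z : ℂ | 2 * ((z - 0) * zeta ^ k).re < 2 * 1 * (1 + √2)} := by
        ext z
        simp only [openOctagon, Set.mem_ofPred_eq, Set.mem_iInter]
        refine ⟨fun h k _ => h k, fun h k => ?_⟩
        have := h (k % 8) (Finset.mem_range.2 (Nat.mod_lt _ (by norm_num)))
        rwa [zeta_pow_mod] at this
      rw [this]
      refine isOpen_biInter_finset fun k _ => isOpen_lt (by fun_prop) (by fun_prop)
    exact interior_maximal hsub hopen

theorem interior_regularOctagon (c : ℂ) {τ : ℝ} (hτ : 0 < τ) :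
    interior (regularOctagon c (τ * apex)) = openOctagon c τ := by
  have hτ' : (τ : ℂ) ≠ 0 := by exact_mod_cast hτ.ne'
  have h : regularOctagon c (τ * apex) = similarity c τ '' table := by
    rw [table, regularOctagon_similarity, mul_zero, add_zero]
  rw [h, ← coe_similarityHomeomorph c hτ', ← Homeomorph.image_interior, interior_table]
  ext z
  obtain ⟨x, rfl⟩ := (similarityHomeomorph c hτ').surjective z
  rw [(similarityHomeomorph c hτ').injective.mem_set_image, coe_similarityHomeomorph]
  simp only [openOctagon, Set.mem_ofPred_eq, similarity, add_sub_cancel_left, sub_zero, mul_assoc,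
    Complex.re_ofReal_mul]
  refine forall_congr' fun k => ?_
  rw [show 2 * (τ * (x * zeta ^ k).re) = τ * (2 * (x * zeta ^ k).re) by ring,
    show 2 * (τ * (1 + √2)) = τ * (2 * (1 * (1 + √2))) by ring, mul_lt_mul_iff_right₀ hτ]

theorem convex_openOctagon (c : ℂ) {τ : ℝ} (hτ : 0 < τ) : Convex ℝ (openOctagon c τ) := by
  rw [← interior_regularOctagon c hτ]; exact (convex_convexHull ℝ _).interior

theorem center_mem_openOctagon (c : ℂ) {τ : ℝ} (hτ : 0 < τ) : c ∈ openOctagon c τ := by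
  intro k
  rw [sub_self, zero_mul, Complex.zero_re, mul_zero]
  positivity

/-! ### The outer billiard map of the octagon -/

/-- The points seen from which the point of right tangency is `apex`. -/
def wedge : Set ℂ := {z | 1 + √2 < z.im ∧ z.im - (1 + √2) < z.re + 1}

theorem isOpen_wedge : IsOpen wedge := by
  have h1 : IsOpen {z : ℂ | 1 + √2 < z.im} := isOpen_lt (by fun_prop) (by fun_prop)
  have h2 : IsOpen {z : ℂ | z.im - (1 + √2) < z.re + 1} := isOpen_lt (by fun_prop) (by fun_prop)
  exact h1.inter h2

theorem isRightTangency_apex_iff {z : ℂ} : IsRightTangency table z apex ↔ z ∈ wedge := by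
  have hs := sqrt_two_mul_self
  have hb := sqrt_two_bounds
  constructor
  · rintro ⟨-, -, h⟩
    -- the two neighbours of `apex` determine the sides of the wedge
    have hne : ∀ k : ℕ, (apex * zeta ^ k).re ≠ -1 → apex * zeta ^ k ≠ apex := by
      intro k hk e
      exact hk (by rw [e]; rfl)
    have h1 := h _ (vertex_mem_table 1) (hne 1 (by simp [apex, zeta]; nlinarith))
    have h7 := h _ (vertex_mem_table 7) (hne 7 (by
      rw [zeta_pow_seven]; simp [apex, zeta]; nlinarith))
    rw [zeta_pow_seven] at h7
    simp [apex, zeta] at h1 h7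
    have h1' : 0 < √2 * ((z.re + 1) - (z.im - (1 + √2))) := by
      linear_combination h1 + (√2 - z.re - z.im) / 2 * hs
    have h7' : 0 < 2 * (z.im - (1 + √2)) := by
      linear_combination h7 + (z.im - z.re - √2 - 2) / 2 * hs
    have := pos_of_mul_pos_right h1' (by linarith)
    constructor <;> linarith
  · rintro ⟨h1, h2⟩
    have hvert := vertex_mem_table 0
    rw [pow_zero, mul_one] at hvert
    refine ⟨fun hz => ?_, hvert, fun y hy hne => ?_⟩
    · have := mem_table_iff.1 hz 6
      rw [zeta_pow_six] at this
      simp at this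
      linarith
    · have hy6 := mem_table_iff.1 hy 6
      have hy1 := mem_table_iff.1 hy 5
      rw [zeta_pow_six] at hy6
      rw [zeta_pow_five] at hy1
      simp [zeta] at hy6 hy1
      have hy5 : y.im - (1 + √2) ≤ y.re + 1 := by nlinarith
      have hcases : y.im < 1 + √2 ∨ -1 < y.re := by
        by_contra! hcon
        apply hne
        apply Complex.ext
        · simp only [apex]; linarith
        · simp only [apex]; linarith
      simp only [apex, map_sub, Complex.mul_im, Complex.sub_re, Complex.sub_im, Complex.conj_re,
        Complex.conj_im]
      have hexp : (-1 - z.re) * (y.im - z.im) + -(1 + √2 - z.im) * (y.re - z.re) =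
          (z.im - (1 + √2)) * ((y.re + 1) - (y.im - (1 + √2))) +
          ((z.re + 1) - (z.im - (1 + √2))) * ((1 + √2) - y.im) := by ring
      have hp1 : 0 ≤ (z.im - (1 + √2)) * ((y.re + 1) - (y.im - (1 + √2))) :=
        mul_nonneg (by linarith) (by linarith)
      have hp2 : 0 ≤ ((z.re + 1) - (z.im - (1 + √2))) * ((1 + √2) - y.im) :=
        mul_nonneg (by linarith) (by linarith)
      rcases hcases with hlt | hlt
      · have : 0 < ((z.re + 1) - (z.im - (1 + √2))) * ((1 + √2) - y.im) :=
          mul_pos (by linarith) (by linarith)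
        linarith
      · rcases hy6.lt_or_eq with h | h
        · have : 0 < ((z.re + 1) - (z.im - (1 + √2))) * ((1 + √2) - y.im) :=
            mul_pos (by linarith) (by linarith)
          linarith
        · have : 0 < (z.im - (1 + √2)) * ((y.re + 1) - (y.im - (1 + √2))) :=
            mul_pos (by linarith) (by linarith)
          linarith

theorem isRightTangency_rotation {k : ℕ} {z v : ℂ} :
    IsRightTangency table (zeta ^ k * z) (zeta ^ k * v) ↔ IsRightTangency table z v := by
  have := isRightTangency_similarity (K := table) (o := 0) (pow_ne_zero k zeta_ne_zero) (x := z)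
    (v := v)
  rwa [similarity_zero_rotation_table, similarity, similarity, zero_add, zero_add] at this

theorem isRightTangency_vertex_iff {k : ℕ} {z : ℂ} :
    IsRightTangency table z (zeta ^ k * apex) ↔ zeta ^ (7 * k) * z ∈ wedge := by
  have e : z = zeta ^ k * (zeta ^ (7 * k) * z) := by
    rw [← mul_assoc, ← pow_add, show k + 7 * k = 8 * k by ring, pow_mul, zeta_pow_eight, one_pow,
      one_mul]
  conv_lhs => rw [e]
  rw [isRightTangency_rotation, isRightTangency_apex_iff]

/-- The point of right tangency is a vertex of the table. -/
theorem IsRightTangency.exists_vertex {z v : ℂ} (h : IsRightTangency table z v) :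
    ∃ k : ℕ, v = zeta ^ k * apex := by
  by_contra! hcon
  have hlin : IsLinearMap ℝ fun y : ℂ => (starRingEnd ℂ (v - z) * y).im :=
    ⟨fun x y => by simp [mul_add], fun a x => by simp; ring⟩
  -- the table would lie strictly to the left of the tangent line
  have hsub : table ⊆ {y | (starRingEnd ℂ (v - z) * z).im < (starRingEnd ℂ (v - z) * y).im} := by
    rw [table, regularOctagon_eq]
    refine convexHull_min ?_ (convex_halfSpace_gt hlin _)
    rintro _ ⟨k, rfl⟩
    have hne : 0 + apex * zeta ^ (k : ℕ) ≠ v := by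
      rw [zero_add, mul_comm]
      exact (hcon k).symm
    have := h.2.2 (0 + apex * zeta ^ (k : ℕ)) (by
      rw [zero_add]; exact vertex_mem_table k) hne
    rw [mul_sub, Complex.sub_im] at this
    simp only [Set.mem_ofPred_eq]
    linarith
  have hv := hsub h.2.1
  simp only [Set.mem_ofPred_eq, map_sub, Complex.mul_im, Complex.sub_re, Complex.sub_im,
    Complex.conj_re, Complex.conj_im] at hv
  linarith

theorem outerBilliard_of_mem_wedge {z : ℂ} (hz : z ∈ wedge) :
    outerBilliard table z = some (2 * apex - z) :=
  outerBilliard_eq_some_iff.2 ⟨apex, isRightTangency_apex_iff.2 hz, rfl⟩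

theorem billiardIter_rotation (n k : ℕ) (z : ℂ) :
    billiardIter table n (zeta ^ k * z) = (billiardIter table n z).map (zeta ^ k * ·) := by
  have e : similarity 0 (zeta ^ k) = (zeta ^ k * ·) := by
    ext x; rw [similarity, zero_add]
  have := billiardIter_similarity (K := table) (o := 0) (pow_ne_zero k zeta_ne_zero) n z
  rwa [similarity_zero_rotation_table, e] at this

theorem rotation_mem_nonfinitePoints {k : ℕ} {z : ℂ} :
    zeta ^ k * z ∈ nonfinitePoints table ↔ z ∈ nonfinitePoints table := by
  have := similarity_mem_nonfinitePoints (K := table) (o := 0) (pow_ne_zero k zeta_ne_zero) (x := z)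
  rwa [similarity_zero_rotation_table, similarity, zero_add] at this

theorem exists_tangency_of_mem_nonfinitePoints {z : ℂ} (hz : z ∈ nonfinitePoints table) :
    ∃ v, IsRightTangency table z v := by
  have := (mem_nonfinitePoints.1 hz).2 1
  rw [billiardIter_one] at this
  obtain ⟨y, hy⟩ := Option.ne_none_iff_exists'.1 this
  obtain ⟨v, hv, -⟩ := outerBilliard_eq_some_iff.1 hy
  exact ⟨v, hv⟩

/-- A connected set of points all of whose iterates are defined cannot cross the boundary of the
wedge. -/
theorem subset_wedge_of_isPreconnected {A : Set ℂ} (hA : IsPreconnected A)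
    (hF : A ⊆ nonfinitePoints table) (hne : (A ∩ wedge).Nonempty) : A ⊆ wedge := by
  refine hA.subset_left_of_subset_union (v := ⋃ k ∈ {k : ℕ | zeta ^ k * apex ≠ apex},
    {z | zeta ^ (7 * k) * z ∈ wedge}) isOpen_wedge ?_ ?_ ?_ hne
  · exact isOpen_biUnion fun k _ => isOpen_wedge.preimage (by fun_prop)
  · rw [Set.disjoint_left]
    intro z hz hz'
    simp only [Set.mem_iUnion] at hz'
    obtain ⟨k, hk, hk'⟩ := hz'
    exact hk ((isRightTangency_vertex_iff.2 hk').unique (isRightTangency_apex_iff.2 hz))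
  · intro z hz
    obtain ⟨v, hv⟩ := exists_tangency_of_mem_nonfinitePoints (hF hz)
    obtain ⟨k, rfl⟩ := hv.exists_vertex
    by_cases hk : zeta ^ k * apex = apex
    · left
      rw [hk] at hv
      exact isRightTangency_apex_iff.1 hv
    · right
      exact Set.mem_biUnion (show k ∈ {k : ℕ | zeta ^ k * apex ≠ apex} from hk)
        (isRightTangency_vertex_iff.1 hv)

/-- Where it is defined, an iterate is locally a translation or a point reflection. -/
theorem eventually_billiardIter {x y : ℂ} {n : ℕ} (h : billiardIter table n x = some y) :
    ∀ᶠ z in 𝓝 x, billiardIter table n z = some (y + (-1) ^ n * (z - x)) := by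
  induction n generalizing y with
  | zero =>
    rw [billiardIter_zero, Option.some_inj] at h
    subst h
    exact Eventually.of_forall fun z => by rw [billiardIter_zero]; congr 1; ring
  | succ n ih =>
    rw [billiardIter_succ, Option.bind_eq_some_iff] at h
    obtain ⟨u, hu, huy⟩ := h
    obtain ⟨v, hv, rfl⟩ := outerBilliard_eq_some_iff.1 huy
    obtain ⟨k, rfl⟩ := hv.exists_vertex
    have hopen : IsOpen {z | IsRightTangency table z (zeta ^ k * apex)} := by
      simp only [isRightTangency_vertex_iff]
      exact isOpen_wedge.preimage (by fun_prop)
    have hlim : Tendsto (fun z => u + (-1) ^ n * (z - x)) (𝓝 x) (𝓝 u) := by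
      have : ContinuousAt (fun z => u + (-1) ^ n * (z - x)) x := by fun_prop
      simpa [ContinuousAt] using this
    filter_upwards [ih hu, hlim (hopen.mem_nhds hv)] with z hz hz'
    rw [billiardIter_succ, hz, Option.bind_some, outerBilliard_eq_some_iff]
    exact ⟨_, hz', by rw [pow_succ]; ring⟩

/-! ### Exact computation with polygons over `ℤ[zeta]` -/

/-- The real number `p + q √2`, for `x = (p, q)`. -/
noncomputable def quadReal (x : ℤ × ℤ) : ℝ := x.1 + x.2 * √2

/-- Decides `0 ≤ p + q √2`. -/
def quadNonneg (x : ℤ × ℤ) : Bool :=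
  (decide (0 ≤ x.1) && decide (0 ≤ x.2)) ||
  (decide (0 ≤ x.1) && decide (2 * (x.2 * x.2) ≤ x.1 * x.1)) ||
  (decide (0 ≤ x.2) && decide (x.1 * x.1 ≤ 2 * (x.2 * x.2)))

/-- Multiplication in `ℤ[√2]`. -/
def quadMul (x y : ℤ × ℤ) : ℤ × ℤ := (x.1 * y.1 + 2 * (x.2 * y.2), x.1 * y.2 + x.2 * y.1)

/-- Decides the order of `ℤ[√2]`. -/
def quadLE (x y : ℤ × ℤ) : Bool := quadNonneg (y - x)

theorem quadReal_add (x y : ℤ × ℤ) : quadReal (x + y) = quadReal x + quadReal y := by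
  simp only [quadReal, Prod.fst_add, Prod.snd_add]; push_cast; ring

theorem quadReal_sub (x y : ℤ × ℤ) : quadReal (x - y) = quadReal x - quadReal y := by
  simp only [quadReal, Prod.fst_sub, Prod.snd_sub]; push_cast; ring

theorem quadReal_mul (x y : ℤ × ℤ) : quadReal (quadMul x y) = quadReal x * quadReal y := by
  simp only [quadReal, quadMul]; push_cast
  linear_combination (-(x.2 : ℝ) * y.2) * sqrt_two_mul_self

theorem quadReal_nonneg {x : ℤ × ℤ} (h : quadNonneg x = true) : 0 ≤ quadReal x := by
  obtain ⟨p, q⟩ := x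
  simp only [quadNonneg, Bool.or_eq_true, Bool.and_eq_true, decide_eq_true_eq] at h
  have hs := sqrt_two_mul_self
  have h0 : (0 : ℝ) ≤ √2 := Real.sqrt_nonneg 2
  simp only [quadReal]
  rcases h with (⟨h1, h2⟩ | ⟨h1, h2⟩) | ⟨h1, h2⟩
  · have h1' : (0 : ℝ) ≤ p := by exact_mod_cast h1
    have h2' : (0 : ℝ) ≤ q := by exact_mod_cast h2
    positivity
  · have h1' : (0 : ℝ) ≤ p := by exact_mod_cast h1
    have h2' : 2 * ((q : ℝ) * q) ≤ p * p := by exact_mod_cast h2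
    have := abs_le_of_sq_le_sq (a := (q : ℝ) * √2) (b := p) (by nlinarith) h1'
    linarith [(abs_le.1 this).1]
  · have h1' : (0 : ℝ) ≤ q := by exact_mod_cast h1
    have h2' : (p : ℝ) * p ≤ 2 * ((q : ℝ) * q) := by exact_mod_cast h2
    have := abs_le_of_sq_le_sq (a := (p : ℝ)) (b := q * √2) (by nlinarith) (by positivity)
    linarith [(abs_le.1 this).1]

theorem quadReal_le {x y : ℤ × ℤ} (h : quadLE x y = true) : quadReal x ≤ quadReal y := by
  have := quadReal_nonneg h
  rw [quadReal_sub] at this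
  linarith

/-- The element `a + b zeta + c zeta ^ 2 + d zeta ^ 3` of `ℤ[zeta]`. -/
structure CycInt where
  a : ℤ
  b : ℤ
  c : ℤ
  d : ℤ

namespace CycInt

/-- The complex number represented by an element of `ℤ[zeta]`. -/
noncomputable def eval (t : CycInt) : ℂ := t.a + t.b * zeta + t.c * zeta ^ 2 + t.d * zeta ^ 3

/-- Addition in `ℤ[zeta]`. -/
def add (s t : CycInt) : CycInt := ⟨s.a + t.a, s.b + t.b, s.c + t.c, s.d + t.d⟩

/-- Multiplication by `zeta`. -/
def rotate (t : CycInt) : CycInt := ⟨-t.d, t.a, t.b, t.c⟩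

/-- Multiplication by `zeta ^ k`. -/
def rotatePow : ℕ → CycInt → CycInt
  | 0, t => t
  | k + 1, t => rotate (rotatePow k t)

/-- Twice the real part, an element of `ℤ[√2]`. -/
def twiceRe (t : CycInt) : ℤ × ℤ := (2 * t.a, t.b - t.d)

theorem eval_add (s t : CycInt) : (add s t).eval = s.eval + t.eval := by
  simp only [eval, add]; push_cast; ring

theorem eval_rotate (t : CycInt) : t.rotate.eval = zeta * t.eval := by
  simp only [eval, rotate]; push_cast
  linear_combination (-(t.d : ℂ)) * zeta_pow_four

theorem eval_rotatePow (k : ℕ) (t : CycInt) : (rotatePow k t).eval = zeta ^ k * t.eval := by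
  induction k with
  | zero => simp [rotatePow]
  | succ k ih => rw [rotatePow, eval_rotate, ih, pow_succ]; ring

theorem quadReal_twiceRe (t : CycInt) : quadReal t.twiceRe = 2 * t.eval.re := by
  simp only [quadReal, twiceRe, eval, zeta_pow_three, zeta_sq]
  simp [zeta]
  ring

end CycInt

/-- The isometry `z ↦ zeta ^ m * z + t` of the plane. -/
structure CycIso where
  m : ℕ
  t : CycInt

namespace CycIso

/-- The isometry as a map. -/
noncomputable def eval (g : CycIso) (z : ℂ) : ℂ := zeta ^ g.m * z + g.t.eval

/-- The isometry "first `f`, then `g`". -/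
def comp (g f : CycIso) : CycIso :=
  ⟨(g.m + f.m) % 8, (f.t.rotatePow g.m).add g.t⟩

theorem eval_comp (g f : CycIso) (z : ℂ) : (g.comp f).eval z = g.eval (f.eval z) := by
  simp only [eval, comp, zeta_pow_mod, CycInt.eval_add, CycInt.eval_rotatePow, pow_add]
  ring

end CycIso

/-- The open half-plane of the points `z` with `2 Re (z zeta ^ dir) < bound`. -/
structure HalfPlane where
  dir : ℕ
  bound : ℤ × ℤ

namespace HalfPlane

/-- `z` lies in the half-plane. -/
def Contains (h : HalfPlane) (z : ℂ) : Prop := 2 * (z * zeta ^ h.dir).re < quadReal h.bound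

/-- The preimage of a half-plane under an isometry. -/
def pullback (g : CycIso) (h : HalfPlane) : HalfPlane :=
  ⟨(g.m + h.dir) % 8, h.bound - (g.t.rotatePow h.dir).twiceRe⟩

theorem contains_pullback {g : CycIso} {h : HalfPlane} {z : ℂ} :
    (h.pullback g).Contains z ↔ h.Contains (g.eval z) := by
  simp only [Contains, pullback, quadReal_sub, CycInt.quadReal_twiceRe, CycInt.eval_rotatePow,
    zeta_pow_mod, CycIso.eval]
  rw [show (zeta ^ g.m * z + g.t.eval) * zeta ^ h.dir =
    z * zeta ^ (g.m + h.dir) + zeta ^ h.dir * g.t.eval by rw [pow_add]; ring, Complex.add_re]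
  constructor <;> intro <;> linarith

/-- `h` contains every point that lies in `h₁` and `h₂`, since the outer normal of `h` is a
combination with coefficients `1` and `√2` of those of `h₁` and `h₂`. -/
def impliedBy (h h₁ h₂ : HalfPlane) : Bool :=
  (h₁.dir == h.dir && quadLE h₁.bound h.bound) ||
  (h₁.dir == (h.dir + 1) % 8 && h₂.dir == (h.dir + 7) % 8 &&
    quadLE (h₁.bound + h₂.bound) (quadMul (0, 1) h.bound)) ||
  (h₁.dir == (h.dir + 1) % 8 && h₂.dir == (h.dir + 6) % 8 &&
    quadLE (quadMul (0, 1) h₁.bound + h₂.bound) h.bound) ||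
  (h₁.dir == (h.dir + 7) % 8 && h₂.dir == (h.dir + 2) % 8 &&
    quadLE (quadMul (0, 1) h₁.bound + h₂.bound) h.bound)

theorem contains_of_impliedBy {h h₁ h₂ : HalfPlane} (hi : h.impliedBy h₁ h₂ = true) {z : ℂ}
    (hz₁ : h₁.Contains z) (hz₂ : h₂.Contains z) : h.Contains z := by
  have hb := sqrt_two_bounds
  have hs := sqrt_two_mul_self
  have h01 : quadReal (0, 1) = √2 := by simp [quadReal]
  simp only [impliedBy, Bool.or_eq_true, Bool.and_eq_true, beq_iff_eq] at hi
  simp only [Contains] at hz₁ hz₂ ⊢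
  rcases hi with ((⟨e, hle⟩ | ⟨⟨e₁, e₂⟩, hle⟩) | ⟨⟨e₁, e₂⟩, hle⟩) | ⟨⟨e₁, e₂⟩, hle⟩ <;>
  have hle := quadReal_le hle
  · rw [e] at hz₁
    linarith
  all_goals
    rw [e₁, zeta_pow_mod, pow_add, ← mul_assoc] at hz₁
    rw [e₂, zeta_pow_mod, pow_add, ← mul_assoc] at hz₂
    rw [quadReal_add, quadReal_mul, h01] at hle
    generalize z * zeta ^ h.dir = u at hz₁ hz₂ ⊢
    simp only [pow_one, zeta_sq, zeta_pow_six, zeta_pow_seven] at hz₁ hz₂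
    simp [zeta] at hz₁ hz₂
  · have : √2 * (2 * u.re) < √2 * quadReal h.bound := by nlinarith
    exact lt_of_mul_lt_mul_left this (by linarith)
  · have : √2 * (2 * (u.re * (√2 / 2) - u.im * (√2 / 2))) < √2 * quadReal h₁.bound :=
      mul_lt_mul_of_pos_left hz₁ (by linarith)
    linear_combination this + hz₂ + hle - (u.re - u.im) * hs
  · have : √2 * (2 * (u.re * (√2 / 2) + u.im * (√2 / 2))) < √2 * quadReal h₁.bound :=
      mul_lt_mul_of_pos_left (by linarith) (by linarith)
    linear_combination this + hz₂ + hle - (u.re + u.im) * hs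

end HalfPlane

/-- The open polygon cut out by a list of half-planes. -/
def polygon (L : List HalfPlane) : Set ℂ := {z | ∀ h ∈ L, h.Contains z}

theorem polygon_append (L M : List HalfPlane) : polygon (L ++ M) = polygon L ∩ polygon M := by
  ext z
  simp only [polygon, List.mem_append, Set.mem_ofPred_eq, Set.mem_inter_iff]
  exact ⟨fun h => ⟨fun x hx => h x (Or.inl hx), fun x hx => h x (Or.inr hx)⟩,
    fun h x hx => hx.elim (h.1 x) (h.2 x)⟩

theorem mem_polygon_pullback {L : List HalfPlane} {g : CycIso} {z : ℂ} :
    z ∈ polygon (L.map (HalfPlane.pullback g)) ↔ g.eval z ∈ polygon L := by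
  simp only [polygon, Set.mem_ofPred_eq, List.forall_mem_map, HalfPlane.contains_pullback]

/-- Decides, by combining at most two inequalities, that `polygon L ⊆ polygon M`. -/
def polygonLE (L M : List HalfPlane) : Bool :=
  M.all fun h => L.any fun h₁ => L.any fun h₂ => h.impliedBy h₁ h₂

theorem polygon_subset {L M : List HalfPlane} (h : polygonLE L M = true) :
    polygon L ⊆ polygon M := by
  intro z hz x hx
  simp only [polygonLE, List.all_eq_true, List.any_eq_true] at h
  obtain ⟨h₁, hh₁, h₂, hh₂, hi⟩ := h x hx
  exact HalfPlane.contains_of_impliedBy hi (hz _ hh₁) (hz _ hh₂)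

theorem polygon_eq {L M : List HalfPlane} (h : polygonLE L M = true) (h' : polygonLE M L = true) :
    polygon L = polygon M :=
  (polygon_subset h).antisymm (polygon_subset h')

/-! ### The induced map on a triangle and its substitution -/

/-- `apex` as an element of `ℤ[zeta]`. -/
def apexCyc : CycInt := ⟨-1, 1, 1, 1⟩

/-- The half-planes that cut out `wedge`. -/
def wedgeSides : List HalfPlane := [⟨2, (-2, -2)⟩, ⟨5, (2, 2)⟩]

/-- The outer billiard map on `wedge`, followed by the rotation through `-k π / 4`. -/
def baseIso (k : ℕ) : CycIso :=
  ⟨(4 + 7 * k) % 8, (apexCyc.add apexCyc).rotatePow ((7 * k) % 8)⟩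

/-- The isometry applied along a word of rotations. -/
def baseWordIso : List ℕ → CycIso
  | [] => ⟨0, ⟨0, 0, 0, 0⟩⟩
  | k :: w => (baseWordIso w).comp (baseIso k)

/-- The half-planes expressing that a point and its images along a word lie in `wedge`. -/
def baseCylinder : List ℕ → List HalfPlane
  | [] => wedgeSides
  | k :: w => wedgeSides ++ (baseCylinder w).map (HalfPlane.pullback (baseIso k))

/-- The three pieces of the map induced on a triangle adjacent to the table. -/
inductive Piece where
  | A
  | B
  | C

namespace Piece

/-- The rotations along the way of a piece back to the triangle. -/
def code : Piece → List ℕ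
  | A => [1]
  | B => [1, 2, 2, 3, 2, 3, 2, 2]
  | C => [1, 2, 2, 3, 2, 3, 2, 3, 2, 3, 2, 3, 2, 2]

/-- The isometry that the induced map applies to a piece. -/
def iso : Piece → CycIso
  | A => ⟨3, ⟨2, 2, 2, 2⟩⟩
  | B => ⟨7, ⟨-4, 0, 4, -4⟩⟩
  | C => ⟨0, ⟨4, -4, 4, 0⟩⟩

/-- The half-planes that cut out a piece. Seen from `apex` the triangle is `0 < y < x < √2`, and it
is divided along the lines `x + y = 2√2 - 2` and `x = 3√2 - 4`. -/
def sides : Piece → List HalfPlane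
  | A => [⟨2, (-2, -2)⟩, ⟨5, (2, 2)⟩, ⟨0, (-2, 2)⟩, ⟨3, (-6, 2)⟩]
  | B => [⟨2, (-2, -2)⟩, ⟨5, (2, 2)⟩, ⟨7, (6, -2)⟩, ⟨4, (10, -6)⟩]
  | C => [⟨2, (-2, -2)⟩, ⟨5, (2, 2)⟩, ⟨0, (-10, 6)⟩]

/-- The substitution that describes the self-similarity of the induced map. -/
def subst : Piece → List Piece
  | A => [C, A]
  | B => [C, A, B, A, B, A, A, A, A, B, A, A, A, A, B, A, B, A]
  | C => [C, A, B, A, B, A, A, A, A, B, A, A, A, A, B, A, A, A, A, B, A, A, A, A, B, A, A, A, A,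
      B, A, B, A]

end Piece

/-- The isometry applied along a word of pieces. -/
def wordIso : List Piece → CycIso
  | [] => ⟨0, ⟨0, 0, 0, 0⟩⟩
  | i :: w => (wordIso w).comp i.iso

/-- The half-planes that cut out the triangle, which is the union of the three pieces but for
their common sides. -/
def triangleSides : List HalfPlane := [⟨2, (-2, -2)⟩, ⟨5, (2, 2)⟩, ⟨0, (-2, 2)⟩]

/-- The half-planes expressing that a point follows a word of pieces and ends in the triangle. -/
def cylinderSides : List Piece → List HalfPlane
  | [] => triangleSides
  | i :: w => i.sides ++ (cylinderSides w).map (HalfPlane.pullback i.iso)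

/-- The image of a half-plane under the contraction by `3 - 2√2` towards `apex`. -/
def HalfPlane.shrink (h : HalfPlane) : HalfPlane :=
  ⟨h.dir, quadMul (3, -2) h.bound + quadMul (-2, 2) (apexCyc.rotatePow h.dir).twiceRe⟩

/-- The half-planes that cut out the open octagon with centre `c`, where `r` is twice its
inradius. -/
def octagonSides (c : CycInt) (r : ℤ × ℤ) : List HalfPlane :=
  (List.range 8).map fun k => ⟨k, (c.rotatePow k).twiceRe + r⟩

theorem baseWordIso_code (i : Piece) : baseWordIso i.code = i.iso := by
  cases i <;> rfl

/-- A piece is cut out by the discontinuities that are met on the way back to the triangle; the final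
`1` says that its points return to the triangle. -/
theorem polygon_baseCylinder (i : Piece) :
    polygon (baseCylinder (i.code ++ [1])) = polygon i.sides := by
  cases i <;> exact polygon_eq (by decide +kernel) (by decide +kernel)

/-- The contraction maps the triangle onto the piece `C`, with which every word of the substitution
starts. -/
theorem polygon_shrink_triangle :
    polygon (triangleSides.map HalfPlane.shrink) = polygon (Piece.sides .C) :=
  polygon_eq (by decide +kernel) (by decide +kernel)

/-- The contracted piece is the set of all points of the small triangle that follow the word of the
substitution; the final `C` says that they return to the small triangle. -/
theorem polygon_cylinderSides_subst (i : Piece) :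
    polygon (cylinderSides (i.subst ++ [.C])) = polygon (i.sides.map HalfPlane.shrink) := by
  cases i <;> exact polygon_eq (by decide +kernel) (by decide +kernel)

theorem polygon_baseCylinder_triangle : polygon (baseCylinder [1]) = polygon triangleSides :=
  polygon_eq (by decide +kernel) (by decide +kernel)

theorem polygon_sides_subset (i : Piece) : polygon i.sides ⊆ polygon triangleSides := by
  cases i <;> exact polygon_subset (by decide +kernel)

theorem polygon_triangleSides_subset : polygon triangleSides ⊆ polygon wedgeSides :=
  polygon_subset (by decide +kernel)

/-- Multiplication by `3 - 2√2` in `ℤ[zeta]`. -/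
def CycInt.shrink (t : CycInt) : CycInt :=
  ⟨3 * t.a - 2 * (t.b - t.d), 3 * t.b - 2 * (t.a + t.c), 3 * t.c - 2 * (t.b + t.d),
    3 * t.d - 2 * (t.c - t.a)⟩

/-- The element `(2√2 - 2) apex` of `ℤ[zeta]`. -/
def shrinkShift : CycInt := ⟨2, -2, 2, 2⟩

/-- The translation parts in the identity saying that the contraction conjugates the isometry of a
piece to that of the substituted word. -/
theorem wordIso_subst_t (i : Piece) :
    (shrinkShift.rotatePow i.iso.m).add (wordIso i.subst).t = i.iso.t.shrink.add shrinkShift := by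
  cases i <;> rfl

theorem wordIso_subst_m (i : Piece) : (wordIso i.subst).m = i.iso.m := by
  cases i <;> rfl

/-- The centre of the octagon of the word `AAAAAAAA`. -/
def centerA : CycInt := ⟨0, 2, 0, 2⟩

/-- The centre of an octagon that returns to itself along the word `AABAA`. -/
def centerD : CycInt := ⟨6, 2, -6, 10⟩

theorem polygon_cylinderSides_A :
    polygon (cylinderSides (List.replicate 8 .A)) = polygon (octagonSides centerA (-2, 2)) :=
  polygon_eq (by decide +kernel) (by decide +kernel)

theorem polygon_cylinderSides_D :
    polygon (cylinderSides (List.replicate 8 [.A, .A, .B, .A, .A]).flatten) =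
      polygon (octagonSides centerD (-14, 10)) :=
  polygon_eq (by decide +kernel) (by decide +kernel)

theorem centerA_fixed :
    (centerA.rotatePow (wordIso [.A]).m).add (wordIso [.A]).t = centerA := rfl

theorem centerD_fixed :
    (centerD.rotatePow (wordIso [.A, .A, .B, .A, .A]).m).add (wordIso [.A, .A, .B, .A, .A]).t =
      centerD := rfl

/-! ### Words of the induced map -/

/-- The points that follow the word `w` of pieces and end in the triangle. -/
def cylinder (w : List Piece) : Set ℂ := polygon (cylinderSides w)

/-- The map applied along the word `w` of pieces. -/
noncomputable def wordMap (w : List Piece) : ℂ → ℂ := (wordIso w).eval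

theorem wordMap_nil (z : ℂ) : wordMap [] z = z := by
  simp [wordMap, wordIso, CycIso.eval, CycInt.eval]

theorem wordMap_cons (i : Piece) (w : List Piece) (z : ℂ) :
    wordMap (i :: w) z = wordMap w (i.iso.eval z) :=
  CycIso.eval_comp _ _ z

theorem wordMap_append (u v : List Piece) (z : ℂ) :
    wordMap (u ++ v) z = wordMap v (wordMap u z) := by
  induction u generalizing z with
  | nil => rw [wordMap_nil, List.nil_append]
  | cons i u ih => rw [List.cons_append, wordMap_cons, wordMap_cons, ih]

theorem mem_cylinder_cons {i : Piece} {w : List Piece} {z : ℂ} :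
    z ∈ cylinder (i :: w) ↔ z ∈ polygon i.sides ∧ i.iso.eval z ∈ cylinder w := by
  rw [cylinder, cylinderSides, polygon_append, Set.mem_inter_iff, mem_polygon_pullback, cylinder]

theorem cylinder_subset_triangle (w : List Piece) : cylinder w ⊆ polygon triangleSides := by
  cases w with
  | nil => exact subset_rfl
  | cons i w => exact fun z hz => polygon_sides_subset i (mem_cylinder_cons.1 hz).1

theorem mem_cylinder_append {u v : List Piece} {z : ℂ} :
    z ∈ cylinder (u ++ v) ↔ z ∈ cylinder u ∧ wordMap u z ∈ cylinder v := by
  induction u generalizing z with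
  | nil =>
    rw [List.nil_append, wordMap_nil]
    exact ⟨fun h => ⟨cylinder_subset_triangle v h, h⟩, And.right⟩
  | cons i u ih =>
    rw [List.cons_append, mem_cylinder_cons, mem_cylinder_cons, wordMap_cons, ih, and_assoc]

theorem mem_baseCylinder_cons {k : ℕ} {w : List ℕ} {z : ℂ} :
    z ∈ polygon (baseCylinder (k :: w)) ↔
      z ∈ polygon wedgeSides ∧ (baseIso k).eval z ∈ polygon (baseCylinder w) := by
  rw [baseCylinder, polygon_append, Set.mem_inter_iff, mem_polygon_pullback]

theorem mem_baseCylinder_append {u v : List ℕ} {z : ℂ} :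
    z ∈ polygon (baseCylinder (u ++ v)) ↔
      z ∈ polygon (baseCylinder u) ∧ (baseWordIso u).eval z ∈ polygon (baseCylinder v) := by
  induction u generalizing z with
  | nil =>
    rw [List.nil_append, show (baseWordIso []).eval z = z from wordMap_nil z]
    refine ⟨fun h => ⟨?_, h⟩, And.right⟩
    cases v with
    | nil => exact h
    | cons k v => exact (mem_baseCylinder_cons.1 h).1
  | cons k u ih =>
    rw [List.cons_append, mem_baseCylinder_cons, mem_baseCylinder_cons, ih, baseWordIso,
      CycIso.eval_comp, and_assoc]

theorem iso_mem_triangle {i : Piece} {z : ℂ} (h : z ∈ polygon i.sides) :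
    i.iso.eval z ∈ polygon triangleSides := by
  rw [← polygon_baseCylinder, mem_baseCylinder_append, baseWordIso_code] at h
  rw [← polygon_baseCylinder_triangle]
  exact h.2

/-- The contraction by `3 - 2√2` towards `apex`. -/
noncomputable def shrinkMap (z : ℂ) : ℂ := ((3 - 2 * √2 : ℝ) : ℂ) * z + shrinkShift.eval

theorem shrinkRatio_pos : 0 < 3 - 2 * √2 := by linarith [sqrt_two_bounds.2]

theorem ofReal_sqrt_two : ((√2 : ℝ) : ℂ) = zeta - zeta ^ 3 := by
  rw [zeta_pow_three]
  apply Complex.ext <;> simp [zeta]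

theorem CycInt.eval_shrink (t : CycInt) :
    t.shrink.eval = ((3 - 2 * √2 : ℝ) : ℂ) * t.eval := by
  push_cast
  rw [ofReal_sqrt_two]
  simp only [CycInt.eval, CycInt.shrink]
  push_cast
  linear_combination (-2 * t.b + 2 * t.d * (1 - zeta ^ 2) - 2 * t.c * zeta) * zeta_pow_four

theorem shrinkShift_eval : shrinkShift.eval = ((2 * √2 - 2 : ℝ) : ℂ) * apex := by
  have hs := sqrt_two_mul_self
  simp only [shrinkShift, CycInt.eval, zeta_sq, zeta_pow_three]
  apply Complex.ext
  · simp [zeta, apex]; linarith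
  · simp [zeta, apex]; linear_combination -2 * hs

theorem apexCyc_eval : apexCyc.eval = apex := by
  simp only [apexCyc, CycInt.eval, zeta_sq, zeta_pow_three]
  apply Complex.ext
  · simp [zeta, apex]
  · simp [zeta, apex]; ring

theorem shrinkMap_surjective : Function.Surjective shrinkMap := by
  intro y
  have : ((3 - 2 * √2 : ℝ) : ℂ) ≠ 0 := by exact_mod_cast shrinkRatio_pos.ne'
  exact ⟨(y - shrinkShift.eval) / ((3 - 2 * √2 : ℝ) : ℂ), by
    rw [shrinkMap, mul_div_cancel₀ _ this, sub_add_cancel]⟩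

theorem HalfPlane.contains_shrink {h : HalfPlane} {z : ℂ} :
    h.shrink.Contains (shrinkMap z) ↔ h.Contains z := by
  have e1 : quadReal (3, -2) = 3 - 2 * √2 := by simp [quadReal]; ring
  have e2 : quadReal (-2, 2) = 2 * √2 - 2 := by simp [quadReal]; ring
  simp only [HalfPlane.Contains, HalfPlane.shrink, quadReal_add, quadReal_mul, e1, e2,
    CycInt.quadReal_twiceRe, CycInt.eval_rotatePow, apexCyc_eval, shrinkMap, shrinkShift_eval]
  rw [add_mul, mul_assoc, mul_assoc, Complex.add_re, Complex.re_ofReal_mul, Complex.re_ofReal_mul,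
    mul_comm apex]
  rw [← mul_lt_mul_iff_right₀ shrinkRatio_pos (b := 2 * (z * zeta ^ h.dir).re)]
  constructor <;> intro <;> linarith

theorem shrinkMap_mem_polygon {L : List HalfPlane} {z : ℂ} :
    shrinkMap z ∈ polygon (L.map HalfPlane.shrink) ↔ z ∈ polygon L := by
  simp only [polygon, Set.mem_ofPred_eq, List.forall_mem_map, HalfPlane.contains_shrink]

theorem wordMap_subst (i : Piece) (z : ℂ) :
    wordMap i.subst (shrinkMap z) = shrinkMap (i.iso.eval z) := by
  have h := congrArg CycInt.eval (wordIso_subst_t i)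
  rw [CycInt.eval_add, CycInt.eval_add, CycInt.eval_rotatePow, CycInt.eval_shrink] at h
  simp only [wordMap, CycIso.eval, shrinkMap, wordIso_subst_m]
  linear_combination h

theorem wordMap_flatMap_subst (w : List Piece) (z : ℂ) :
    wordMap (w.flatMap Piece.subst) (shrinkMap z) = shrinkMap (wordMap w z) := by
  induction w generalizing z with
  | nil => rw [List.flatMap_nil, wordMap_nil, wordMap_nil]
  | cons i w ih => rw [List.flatMap_cons, wordMap_append, wordMap_subst, ih, wordMap_cons]

theorem mem_cylinder_singleton {i : Piece} {z : ℂ} :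
    z ∈ cylinder [i] ↔ z ∈ polygon i.sides := by
  rw [mem_cylinder_cons]
  exact ⟨And.left, fun h => ⟨h, iso_mem_triangle h⟩⟩

/-- The contraction maps the points that follow `w` onto those that follow the substituted word and
return to the small triangle, which is the piece `C`. -/
theorem shrinkMap_mem_cylinder {w : List Piece} {z : ℂ} :
    shrinkMap z ∈ cylinder (w.flatMap Piece.subst ++ [.C]) ↔ z ∈ cylinder w := by
  induction w generalizing z with
  | nil =>
    rw [List.flatMap_nil, List.nil_append, mem_cylinder_singleton, ← polygon_shrink_triangle,
      shrinkMap_mem_polygon]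
    rfl
  | cons i w ih =>
    rw [List.flatMap_cons, List.append_assoc, mem_cylinder_append, wordMap_subst, ih,
      mem_cylinder_cons, ← shrinkMap_mem_polygon, ← polygon_cylinderSides_subst]
    change _ ↔ shrinkMap z ∈ cylinder _ ∧ _
    rw [mem_cylinder_append, wordMap_subst, mem_cylinder_singleton, ← polygon_shrink_triangle,
      shrinkMap_mem_polygon]
    constructor
    · exact fun h => ⟨⟨h.1, cylinder_subset_triangle w h.2⟩, h.2⟩
    · exact fun h => ⟨h.1.1, h.2⟩

/-! ### Orbits and components of the outer billiard map along words -/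

theorem polygon_wedgeSides : polygon wedgeSides = wedge := by
  ext z
  have hs := sqrt_two_mul_self
  have hb := sqrt_two_bounds
  simp only [polygon, wedgeSides, wedge, List.mem_cons, List.not_mem_nil, or_false,
    forall_eq_or_imp, forall_eq, HalfPlane.Contains, quadReal, zeta_sq, zeta_pow_five,
    Set.mem_ofPred_eq]
  simp [zeta]
  refine and_congr ⟨fun h => by linarith, fun h => by linarith⟩ ?_
  rw [← mul_lt_mul_iff_right₀ (show 0 < √2 by linarith)]
  constructor <;> intro h <;> nlinarith

theorem outerBilliard_of_mem_wedgeSides (k : ℕ) {z : ℂ} (hz : z ∈ polygon wedgeSides) :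
    outerBilliard table z = some (zeta ^ k * (baseIso k).eval z) := by
  rw [polygon_wedgeSides] at hz
  rw [outerBilliard_of_mem_wedge hz]
  congr 1
  simp only [baseIso, CycIso.eval, CycInt.eval_rotatePow, zeta_pow_mod, CycInt.eval_add,
    apexCyc_eval]
  have e : zeta ^ k * zeta ^ (7 * k) = 1 := by
    rw [← pow_add, show k + 7 * k = 8 * k by ring, pow_mul, zeta_pow_eight, one_pow]
  rw [pow_add, zeta_pow_four]
  linear_combination (z - 2 * apex) * e

theorem billiardIter_of_mem_baseCylinder {w : List ℕ} {z : ℂ}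
    (hz : z ∈ polygon (baseCylinder w)) :
    billiardIter table w.length z = some (zeta ^ w.sum * (baseWordIso w).eval z) := by
  induction w generalizing z with
  | nil =>
    rw [show (baseWordIso []).eval z = z from wordMap_nil z]
    simp [billiardIter_zero]
  | cons k w ih =>
    rw [mem_baseCylinder_cons] at hz
    have h1 := outerBilliard_of_mem_wedgeSides k hz.1
    rw [← billiardIter_one] at h1
    rw [List.length_cons, add_comm, billiardIter_add h1, billiardIter_rotation, ih hz.2,
      Option.map_some, baseWordIso, CycIso.eval_comp, List.sum_cons, pow_add, mul_assoc]

theorem billiardIter_of_mem_piece {i : Piece} {z : ℂ} (hz : z ∈ polygon i.sides) :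
    billiardIter table i.code.length z = some (zeta ^ i.code.sum * i.iso.eval z) := by
  rw [← polygon_baseCylinder, mem_baseCylinder_append] at hz
  rw [billiardIter_of_mem_baseCylinder hz.1, baseWordIso_code]

/-- The number of iterations of the outer billiard map along a word of pieces. -/
def wordTime (w : List Piece) : ℕ := (w.map fun i => i.code.length).sum

/-- The number of eighths of a full turn by which the outer billiard map gets ahead along a word of
pieces. -/
def wordTurn (w : List Piece) : ℕ := (w.map fun i => i.code.sum).sum

theorem length_le_wordTime (w : List Piece) : w.length ≤ wordTime w := by
  induction w with
  | nil => exact Nat.zero_le _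
  | cons i w ih =>
    have : 1 ≤ i.code.length := by cases i <;> simp [Piece.code]
    simp only [wordTime, List.map_cons, List.sum_cons, List.length_cons] at ih ⊢
    omega

theorem billiardIter_of_mem_cylinder {w : List Piece} {z : ℂ} (hz : z ∈ cylinder w) :
    billiardIter table (wordTime w) z = some (zeta ^ wordTurn w * wordMap w z) := by
  induction w generalizing z with
  | nil => simp [wordMap_nil, wordTime, wordTurn, billiardIter_zero]
  | cons i w ih =>
    rw [mem_cylinder_cons] at hz
    rw [wordTime, List.map_cons, List.sum_cons, billiardIter_add (billiardIter_of_mem_piece hz.1),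
      billiardIter_rotation, ← wordTime, ih hz.2, Option.map_some, wordMap_cons,
      show wordTurn (i :: w) = i.code.sum + wordTurn w from rfl, pow_add, mul_assoc]

theorem triangle_disjoint_table {z : ℂ} (hz : z ∈ polygon triangleSides) : z ∉ table := by
  have := polygon_triangleSides_subset hz
  rw [polygon_wedgeSides, ← isRightTangency_apex_iff] at this
  exact this.1

theorem subset_baseCylinder {w : List ℕ} {A : Set ℂ} (hA : IsPreconnected A)
    (hF : A ⊆ nonfinitePoints table) (hne : (A ∩ polygon (baseCylinder w)).Nonempty) :
    A ⊆ polygon (baseCylinder w) ∧ (baseWordIso w).eval '' A ⊆ nonfinitePoints table := by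
  have hcont : ∀ g : CycIso, Continuous g.eval := fun g => by unfold CycIso.eval; fun_prop
  induction w generalizing A with
  | nil =>
    rw [baseCylinder, polygon_wedgeSides] at hne ⊢
    refine ⟨subset_wedge_of_isPreconnected hA hF hne, ?_⟩
    rintro _ ⟨z, hz, rfl⟩
    rw [show (baseWordIso []).eval z = z from wordMap_nil z]
    exact hF hz
  | cons k w ih =>
    obtain ⟨z, hzA, hz⟩ := hne
    rw [mem_baseCylinder_cons] at hz
    have hW : A ⊆ polygon wedgeSides := by
      have hz1 := hz.1
      rw [polygon_wedgeSides] at hz1 ⊢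
      exact subset_wedge_of_isPreconnected hA hF ⟨z, hzA, hz1⟩
    have hF' : (baseIso k).eval '' A ⊆ nonfinitePoints table := by
      rintro _ ⟨y, hy, rfl⟩
      have h1 := outerBilliard_of_mem_wedgeSides k (hW hy)
      rw [← billiardIter_one] at h1
      exact rotation_mem_nonfinitePoints.1 (billiardIter_mem_nonfinitePoints (hF hy) h1)
    obtain ⟨h2, h3⟩ := ih (hA.image _ (hcont _).continuousOn) hF'
      ⟨_, Set.mem_image_of_mem _ hzA, hz.2⟩
    constructor
    · exact fun y hy => mem_baseCylinder_cons.2 ⟨hW hy, h2 (Set.mem_image_of_mem _ hy)⟩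
    · rintro _ ⟨y, hy, rfl⟩
      rw [baseWordIso, CycIso.eval_comp]
      exact h3 (Set.mem_image_of_mem _ (Set.mem_image_of_mem _ hy))

/-- A connected set of points all of whose iterates are defined cannot leave a cylinder, because it
would have to cross a discontinuity of some iterate. -/
theorem subset_cylinder {w : List Piece} {A : Set ℂ} (hA : IsPreconnected A)
    (hF : A ⊆ nonfinitePoints table) (hne : (A ∩ cylinder w).Nonempty) : A ⊆ cylinder w := by
  have hcont : ∀ g : CycIso, Continuous g.eval := fun g => by unfold CycIso.eval; fun_prop
  induction w generalizing A with
  | nil =>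
    rw [cylinder, cylinderSides, ← polygon_baseCylinder_triangle] at hne ⊢
    exact (subset_baseCylinder hA hF hne).1
  | cons i w ih =>
    obtain ⟨z, hzA, hz⟩ := hne
    rw [mem_cylinder_cons] at hz
    have hP : A ⊆ polygon i.sides := by
      have hz1 := hz.1
      rw [← polygon_baseCylinder] at hz1 ⊢
      exact (subset_baseCylinder hA hF ⟨z, hzA, hz1⟩).1
    have hF' : i.iso.eval '' A ⊆ nonfinitePoints table := by
      rintro _ ⟨y, hy, rfl⟩
      exact rotation_mem_nonfinitePoints.1
        (billiardIter_mem_nonfinitePoints (hF hy) (billiardIter_of_mem_piece (hP hy)))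
    have h2 := ih (hA.image _ (hcont _).continuousOn) hF' ⟨_, Set.mem_image_of_mem _ hzA, hz.2⟩
    exact fun y hy => mem_cylinder_cons.2 ⟨hP hy, h2 (Set.mem_image_of_mem _ hy)⟩

/-- On a connected set of points all of whose iterates are defined, each iterate is a translation or
a point reflection. -/
theorem billiardIter_of_isPreconnected {A : Set ℂ} (hA : IsPreconnected A)
    (hF : A ⊆ nonfinitePoints table) {n : ℕ} {x y u : ℂ} (hx : x ∈ A) (hy : y ∈ A)
    (hu : billiardIter table n x = some u) :
    billiardIter table n y = some (u + (-1) ^ n * (y - x)) := by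
  have hdef : ∀ z ∈ A, ∃ v, billiardIter table n z = some v := fun z hz =>
    Option.ne_none_iff_exists'.1 ((mem_nonfinitePoints.1 (hF hz)).2 n)
  have := isPreconnected_iff_preconnectedSpace.1 hA
  let f : A → ℂ := fun z => (billiardIter table n z).getD 0 - (-1) ^ n * (z : ℂ)
  have hf : IsLocallyConstant f := by
    rw [IsLocallyConstant.iff_eventually_eq]
    intro z
    obtain ⟨v, hv⟩ := hdef z z.2
    filter_upwards [continuous_subtype_val.continuousAt.eventually (eventually_billiardIter hv)]
      with z' hz'
    simp only [f, hv, hz', Option.getD_some]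
    ring
  have h := hf.apply_eq_of_preconnectedSpace ⟨y, hy⟩ ⟨x, hx⟩
  obtain ⟨v, hv⟩ := hdef y hy
  simp only [f, hu, hv, Option.getD_some] at h
  rw [hv]
  congr 1
  linear_combination h

/-- The open octagon with centre `c` and ratio `τ` returns to itself along a word `w`, and it
consists exactly of the points that follow some prolongation of `w`. -/
def IsReturningOctagon (c : ℂ) (τ : ℝ) : Prop :=
  0 < τ ∧ ∃ w w' : List Piece, w ≠ [] ∧ wordMap w c = c ∧ cylinder (w ++ w') = openOctagon c τ

theorem CycIso.eval_mem_openOctagon {g : CycIso} {c z : ℂ} {τ : ℝ} :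
    g.eval z ∈ openOctagon (g.eval c) τ ↔ z ∈ openOctagon c τ :=
  openOctagon_mem_smul_iff

theorem exists_billiardIter_eq_self {c : ℂ} {τ : ℝ} (h : IsReturningOctagon c τ) :
    ∃ N, 0 < N ∧ ∀ z ∈ openOctagon c τ, billiardIter table N z = some z := by
  obtain ⟨-, w, w', hw, hc, hcyl⟩ := h
  refine ⟨8 * wordTime w, ?_, fun z hz => ?_⟩
  · have := length_le_wordTime w
    have := List.length_pos_iff.2 hw
    omega
  · have hmem : ∀ z ∈ openOctagon c τ, z ∈ cylinder w := fun z hz =>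
      (mem_cylinder_append.1 (hcyl ▸ hz)).1
    have hinv : ∀ z ∈ openOctagon c τ, wordMap w z ∈ openOctagon c τ := fun z hz => by
      have := (CycIso.eval_mem_openOctagon (g := wordIso w)).2 hz
      rwa [← wordMap, hc] at this
    have hrot : ∀ z, wordMap w z - c = zeta ^ (wordIso w).m * (z - c) := fun z => by
      have : wordMap w z - wordMap w c = zeta ^ (wordIso w).m * (z - c) := by
        simp only [wordMap, CycIso.eval]; ring
      rwa [hc] at this
    have key : ∀ j, ∃ y ∈ openOctagon c τ, y - c = (zeta ^ (wordIso w).m) ^ j * (z - c) ∧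
        billiardIter table (j * wordTime w) z = some ((zeta ^ wordTurn w) ^ j * y) := by
      intro j
      induction j with
      | zero => exact ⟨z, hz, by ring, by simp [billiardIter_zero]⟩
      | succ j ih =>
        obtain ⟨y, hy, hyc, hj⟩ := ih
        refine ⟨wordMap w y, hinv y hy, by rw [hrot, hyc]; ring, ?_⟩
        rw [add_mul, one_mul, billiardIter_add hj, ← pow_mul, billiardIter_rotation,
          billiardIter_of_mem_cylinder (hmem y hy), Option.map_some]
        congr 1
        ring
    obtain ⟨y, -, hyc, h8⟩ := key 8
    have hone : ∀ n : ℕ, (zeta ^ n) ^ 8 = 1 := fun n => by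
      rw [← pow_mul, mul_comm, pow_mul, zeta_pow_eight, one_pow]
    rw [hone, one_mul, sub_left_inj] at hyc
    rw [h8, hone, one_mul, hyc]

theorem openOctagon_subset_nonfinitePoints {c : ℂ} {τ : ℝ} (h : IsReturningOctagon c τ) :
    openOctagon c τ ⊆ nonfinitePoints table := by
  intro z hz
  obtain ⟨N, hN, hper⟩ := exists_billiardIter_eq_self h
  obtain ⟨-, w, w', -, -, hcyl⟩ := h
  exact mem_nonfinitePoints_of_periodic
    (triangle_disjoint_table (cylinder_subset_triangle _ (hcyl ▸ hz))) hN (hper z hz)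

theorem subset_openOctagon {c : ℂ} {τ : ℝ} (h : IsReturningOctagon c τ) {A : Set ℂ}
    (hA : IsPreconnected A) (hF : A ⊆ nonfinitePoints table)
    (hne : (A ∩ openOctagon c τ).Nonempty) : A ⊆ openOctagon c τ := by
  obtain ⟨-, w, w', -, -, hcyl⟩ := h
  rw [← hcyl] at hne ⊢
  exact subset_cylinder hA hF hne

theorem isBilliardComponent_openOctagon {c : ℂ} {τ : ℝ} (h : IsReturningOctagon c τ) :
    IsBilliardComponent table (openOctagon c τ) := by
  have hc := center_mem_openOctagon c h.1
  have hF := openOctagon_subset_nonfinitePoints h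
  refine ⟨c, hF hc, ?_⟩
  apply Set.Subset.antisymm
  · exact (convex_openOctagon c h.1).isPreconnected.subset_connectedComponentIn hc hF
  · exact subset_openOctagon h isPreconnected_connectedComponentIn
      (connectedComponentIn_subset _ _) ⟨c, mem_connectedComponentIn (hF hc), hc⟩

theorem nonpos_of_forall_mul_lt {a R : ℝ} (h : ∀ n : ℕ, n * a < R) : a ≤ 0 := by
  by_contra! ha
  obtain ⟨n, hn⟩ := exists_nat_gt (R / a)
  rw [div_lt_iff₀ ha] at hn
  exact absurd (h n) hn.not_gt

/-- An octagon has a single centre of symmetry. -/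
theorem eq_center_of_symmetric {c x : ℂ} {τ : ℝ} (hτ : 0 < τ)
    (h : ∀ y ∈ openOctagon c τ, 2 * x - y ∈ openOctagon c τ) : x = c := by
  -- the composition with the reflection in the centre is a translation
  have htr : ∀ n : ℕ, c + n * (2 * (x - c)) ∈ openOctagon c τ := by
    intro n
    induction n with
    | zero => simpa using center_mem_openOctagon c hτ
    | succ n ih =>
      have hsym : 2 * c - (c + n * (2 * (x - c))) ∈ openOctagon c τ := by
        intro k
        have := ih (k + 4)
        rw [pow_add, zeta_pow_four] at this
        convert this using 3
        ring
      convert h _ hsym using 1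
      push_cast
      ring
  have hdir : ∀ k : ℕ, ((x - c) * zeta ^ k).re ≤ 0 := by
    intro k
    refine nonpos_of_forall_mul_lt (R := 2 * τ * (1 + √2) / 4) fun n => ?_
    have := htr n k
    rw [add_sub_cancel_left, mul_assoc, mul_assoc, ← Complex.ofReal_natCast,
      Complex.re_ofReal_mul, ← Complex.ofReal_ofNat, Complex.re_ofReal_mul] at this
    linarith
  have h0 := hdir 0
  have h2 := hdir 2
  have h4 := hdir 4
  have h6 := hdir 6
  rw [zeta_sq] at h2
  rw [zeta_pow_four] at h4
  rw [zeta_pow_six] at h6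
  simp at h0 h2 h4 h6
  apply Complex.ext <;> linarith

theorem exists_hasPeriod {c : ℂ} {τ : ℝ} (h : IsReturningOctagon c τ) :
    ∃ p, ∀ x ∈ openOctagon c τ, IsPeriodicPoint table x ∧ (x ≠ c → HasPeriod table x p) := by
  obtain ⟨N, hN, hper⟩ := exists_billiardIter_eq_self h
  have hF := openOctagon_subset_nonfinitePoints h
  have hpre := (convex_openOctagon c h.1).isPreconnected
  have hP : ∀ x ∈ openOctagon c τ, IsPeriodicPoint table x := fun x hx =>
    isPeriodicPoint_iff.2 ⟨N, hN, hper x hx⟩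
  -- an iterate that fixes a point other than the centre is the identity
  have hfix : ∀ x ∈ openOctagon c τ, x ≠ c → ∀ n, billiardIter table n x = some x →
      ∀ y ∈ openOctagon c τ, billiardIter table n y = some y := by
    intro x hx hxc n hn y hy
    have hn' := fun y hy => billiardIter_of_isPreconnected hpre hF (y := y) hx hy hn
    rcases Nat.even_or_odd n with he | ho
    · rw [hn' y hy, he.neg_one_pow]
      congr 1
      ring
    · exfalso
      have hn'' : ∀ y ∈ openOctagon c τ, billiardIter table n y = some (2 * x - y) := by
        intro y hy
        rw [hn' y hy, ho.neg_one_pow]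
        congr 1
        ring
      apply hxc
      refine eq_center_of_symmetric h.1 fun y hy => ?_
      refine subset_openOctagon h (A := (fun y => 2 * x - y) '' openOctagon c τ)
        (hpre.image _ (by fun_prop)) ?_ ⟨x, ⟨x, hx, by ring⟩, hx⟩ ⟨y, hy, rfl⟩
      rintro _ ⟨y, hy, rfl⟩
      exact billiardIter_mem_nonfinitePoints (hF hy) (hn'' y hy)
  by_cases hex : ∃ x₀ ∈ openOctagon c τ, x₀ ≠ c
  · obtain ⟨x₀, hx₀, hne⟩ := hex
    obtain ⟨p, hp⟩ := hP x₀ hx₀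
    refine ⟨p, fun x hx => ⟨hP x hx, fun hxc => ?_⟩⟩
    have : {n : ℕ | 0 < n ∧ billiardIter table n x = some x} =
        {n : ℕ | 0 < n ∧ billiardIter table n x₀ = some x₀} := by
      ext n
      exact and_congr_right fun _ =>
        ⟨fun hn => hfix x hx hxc n hn x₀ hx₀, fun hn => hfix x₀ hx₀ hne n hn x hx⟩
    rw [HasPeriod, this]
    exact hp
  · push Not at hex
    exact ⟨0, fun x hx => ⟨hP x hx, fun hxc => absurd (hex x hx) hxc⟩⟩

/-! ### The spiral similarity and the limit point -/

/-- If an octagon returns to itself along a word, then so does its image under the first letter,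
along the word in which this letter is moved to the end. -/
theorem cylinder_shift {i : Piece} {w w' : List Piece} {c : ℂ} {τ : ℝ}
    (hc : wordMap (i :: w) c = c) (hcyl : cylinder ((i :: w) ++ w') = openOctagon c τ) :
    wordMap (w ++ [i]) (i.iso.eval c) = i.iso.eval c ∧
      cylinder ((w ++ [i]) ++ (w ++ w')) = openOctagon (i.iso.eval c) τ := by
  have hw : wordMap w (i.iso.eval c) = c := by rw [← wordMap_cons, hc]
  constructor
  · rw [wordMap_append, hw, wordMap_cons, wordMap_nil]
  · ext z
    rw [show (w ++ [i]) ++ (w ++ w') = w ++ ((i :: w) ++ w') by simp, mem_cylinder_append, hcyl]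
    conv in openOctagon c τ => rw [← hw]
    rw [wordMap, CycIso.eval_mem_openOctagon]
    refine ⟨And.right, fun hz => ⟨?_, hz⟩⟩
    obtain ⟨y, rfl⟩ : ∃ y, i.iso.eval y = z := by
      refine ⟨(z - i.iso.t.eval) / zeta ^ i.iso.m, ?_⟩
      rw [CycIso.eval, mul_div_cancel₀ _ (pow_ne_zero _ zeta_ne_zero), sub_add_cancel]
    rw [CycIso.eval_mem_openOctagon, ← hcyl, mem_cylinder_append] at hz
    exact (mem_cylinder_cons.1 hz.1).2

theorem shrinkMap_mem_openOctagon {c z : ℂ} {τ : ℝ} :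
    shrinkMap z ∈ openOctagon (shrinkMap c) ((3 - 2 * √2) * τ) ↔ z ∈ openOctagon c τ := by
  refine forall_congr' fun k => ?_
  rw [show (shrinkMap z - shrinkMap c) * zeta ^ k =
    ((3 - 2 * √2 : ℝ) : ℂ) * ((z - c) * zeta ^ k) by simp only [shrinkMap]; ring,
    Complex.re_ofReal_mul, ← mul_lt_mul_iff_right₀ shrinkRatio_pos
      (b := 2 * ((z - c) * zeta ^ k).re)]
  constructor <;> intro <;> linarith

theorem exists_subst_eq (i : Piece) : ∃ r, i.subst = .C :: .A :: r := by
  cases i <;> exact ⟨_, rfl⟩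

theorem cylinder_shrink {w w' : List Piece} {c : ℂ} {τ : ℝ} (hc : wordMap w c = c)
    (hcyl : cylinder (w ++ w') = openOctagon c τ) :
    wordMap (w.flatMap Piece.subst) (shrinkMap c) = shrinkMap c ∧
      cylinder (w.flatMap Piece.subst ++ (w'.flatMap Piece.subst ++ [.C])) =
        openOctagon (shrinkMap c) ((3 - 2 * √2) * τ) := by
  refine ⟨by rw [wordMap_flatMap_subst, hc], ?_⟩
  ext z
  obtain ⟨z, rfl⟩ := shrinkMap_surjective z
  rw [shrinkMap_mem_openOctagon, ← hcyl, ← List.append_assoc, ← List.flatMap_append,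
    shrinkMap_mem_cylinder]

/-- The contraction towards `apex`, followed by two steps of the induced map. These steps are
common to all the words of the substitution. -/
noncomputable def spiralMap (z : ℂ) : ℂ :=
  (Piece.iso .A).eval ((Piece.iso .C).eval (shrinkMap z))

theorem IsReturningOctagon.spiralMap {c : ℂ} {τ : ℝ} (h : IsReturningOctagon c τ) :
    IsReturningOctagon (spiralMap c) ((3 - 2 * √2) * τ) := by
  obtain ⟨hτ, w, w', hw, hc, hcyl⟩ := h
  refine ⟨mul_pos shrinkRatio_pos hτ, ?_⟩
  obtain ⟨h1, h2⟩ := cylinder_shrink hc hcyl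
  obtain ⟨i, v, rfl⟩ := List.exists_cons_of_ne_nil hw
  obtain ⟨r, hr⟩ := exists_subst_eq i
  rw [List.flatMap_cons, hr, List.cons_append, List.cons_append] at h1 h2
  obtain ⟨h3, h4⟩ := cylinder_shift h1 h2
  rw [List.cons_append] at h3 h4
  obtain ⟨h5, h6⟩ := cylinder_shift h3 h4
  exact ⟨_, _, by simp, h5, h6⟩

/-- The fixed point of the spiral similarity. -/
noncomputable def limitPoint : ℂ := ⟨(10 * √2 - 26) / 17, (28 * √2 + 2) / 17⟩

theorem spiralMap_sub_limitPoint (z : ℂ) :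
    spiralMap z - limitPoint = ((3 - 2 * √2 : ℝ) : ℂ) * zeta ^ 3 * (z - limitPoint) := by
  have hfix : spiralMap limitPoint = limitPoint := by
    have hs := sqrt_two_mul_self
    simp only [spiralMap, CycIso.eval, Piece.iso, shrinkMap, shrinkShift, CycInt.eval,
      zeta_sq, zeta_pow_three, pow_zero]
    apply Complex.ext
    · simp [zeta, limitPoint]
      linear_combination (38 * √2 - 30) / 17 * hs
    · simp [zeta, limitPoint]
      linear_combination (18 * √2 - 16) / 17 * hs
  have : spiralMap z - spiralMap limitPoint =
      ((3 - 2 * √2 : ℝ) : ℂ) * zeta ^ 3 * (z - limitPoint) := by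
    simp only [spiralMap, CycIso.eval, Piece.iso, shrinkMap]
    ring
  rwa [hfix] at this

/-- The ratio of the homothety that eight turns of the spiral amount to. -/
noncomputable def ratio : ℝ := (3 - 2 * √2) ^ 8

theorem ratio_pos : 0 < ratio := pow_pos shrinkRatio_pos 8

theorem ratio_lt_one : ratio < 1 :=
  pow_lt_one₀ shrinkRatio_pos.le (by linarith [sqrt_two_bounds.1]) (by norm_num)

theorem IsReturningOctagon.homothety {c : ℂ} {τ : ℝ} (h : IsReturningOctagon c τ) (n : ℕ) :
    IsReturningOctagon (limitPoint + (ratio : ℂ) ^ n * (c - limitPoint)) (ratio ^ n * τ) := by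
  have key : ∀ j : ℕ, IsReturningOctagon
      (limitPoint + (((3 - 2 * √2 : ℝ) : ℂ) * zeta ^ 3) ^ j * (c - limitPoint))
      ((3 - 2 * √2) ^ j * τ) := by
    intro j
    induction j with
    | zero => simpa using h
    | succ j ih =>
      convert ih.spiralMap using 1
      · rw [sub_eq_iff_eq_add'.1 (spiralMap_sub_limitPoint _)]
        ring
      · ring
  convert key (8 * n) using 1
  · rw [mul_pow, pow_mul, pow_mul, ← pow_mul zeta, mul_comm 3 8, pow_mul zeta, zeta_pow_eight,
      one_pow, one_pow, mul_one, ratio]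
    push_cast
    rfl
  · rw [ratio, pow_mul]

theorem limitPoint_mem_piece : limitPoint ∈ polygon (Piece.sides .B) := by
  have hs := sqrt_two_mul_self
  have hb := sqrt_two_bounds
  simp only [polygon, Piece.sides, List.mem_cons, List.not_mem_nil, or_false,
    forall_eq_or_imp, forall_eq, HalfPlane.Contains, quadReal, zeta_sq, zeta_pow_four,
    zeta_pow_five, zeta_pow_seven, Set.mem_ofPred_eq]
  refine ⟨?_, ?_, ?_, ?_⟩ <;> simp [zeta, limitPoint] <;> nlinarith

theorem spiralMap_limitPoint : spiralMap limitPoint = limitPoint := by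
  rw [← sub_eq_zero, spiralMap_sub_limitPoint, sub_self, mul_zero]

theorem limitPoint_mem_cylinder_step {w r : List Piece} (h : limitPoint ∈ cylinder w)
    (hr : w.flatMap Piece.subst = .C :: .A :: r) : limitPoint ∈ cylinder (r ++ [.C]) := by
  rw [← shrinkMap_mem_cylinder, hr, List.cons_append, List.cons_append, mem_cylinder_cons,
    mem_cylinder_cons] at h
  rw [← spiralMap_limitPoint]
  exact h.2.2

/-- The limit point follows words of any length: by its self-similarity a word that it follows can be
replaced by the substituted word without the first two letters. -/
theorem exists_long_word (n : ℕ) : ∃ w, n + 2 ≤ w.length ∧ limitPoint ∈ cylinder w := by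
  induction n with
  | zero =>
    exact ⟨_, by simp, limitPoint_mem_cylinder_step
      (mem_cylinder_singleton.2 limitPoint_mem_piece) (List.flatMap_singleton _ _)⟩
  | succ n ih =>
    obtain ⟨w, hn, hw⟩ := ih
    have hlen : ∀ w : List Piece, 2 * w.length ≤ (w.flatMap Piece.subst).length := by
      intro w
      induction w with
      | nil => simp
      | cons j w ih =>
        obtain ⟨r, hr⟩ := exists_subst_eq j
        rw [List.flatMap_cons, hr]
        simp only [List.length_append, List.length_cons] at ih ⊢
        omega
    obtain ⟨i, v, rfl⟩ := List.exists_cons_of_ne_nil (l := w) (by rintro rfl; simp at hn)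
    obtain ⟨r, hr⟩ := exists_subst_eq i
    have h1 := hlen (i :: v)
    have e : (i :: v).flatMap Piece.subst = .C :: .A :: (r ++ v.flatMap Piece.subst) := by
      rw [List.flatMap_cons, hr]; rfl
    refine ⟨_, ?_, limitPoint_mem_cylinder_step hw e⟩
    rw [e] at h1
    simp only [List.length_append, List.length_cons, List.length_nil] at h1 hn ⊢
    omega

theorem limitPoint_mem_nonfinitePoints : limitPoint ∈ nonfinitePoints table := by
  rw [mem_nonfinitePoints]
  refine ⟨triangle_disjoint_table (polygon_sides_subset _ limitPoint_mem_piece), fun n => ?_⟩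
  obtain ⟨w, hn, hw⟩ := exists_long_word n
  refine billiardIter_of_le (n := wordTime w) ?_ (by linarith [length_le_wordTime w])
  rw [billiardIter_of_mem_cylinder hw]
  exact Option.some_ne_none _

/-! ### Three initial octagons -/

theorem polygon_octagonSides {c : CycInt} {r : ℤ × ℤ} {τ : ℝ}
    (hr : quadReal r = 2 * τ * (1 + √2)) : polygon (octagonSides c r) = openOctagon c.eval τ := by
  have h : ∀ (k : ℕ) (z : ℂ), (2 * (z * zeta ^ k).re <
      quadReal ((c.rotatePow k).twiceRe + r)) ↔
      2 * ((z - c.eval) * zeta ^ k).re < 2 * τ * (1 + √2) := by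
    intro k z
    rw [quadReal_add, hr, CycInt.quadReal_twiceRe, CycInt.eval_rotatePow, sub_mul, Complex.sub_re,
      mul_comm c.eval]
    constructor <;> intro <;> linarith
  ext z
  simp only [polygon, octagonSides, List.forall_mem_map, List.mem_range, HalfPlane.Contains,
    Set.mem_ofPred_eq, h, openOctagon]
  refine ⟨fun hz k => ?_, fun hz k _ => hz k⟩
  have := hz (k % 8) (Nat.mod_lt _ (by norm_num))
  rwa [zeta_pow_mod] at this

theorem isReturningOctagon_A : IsReturningOctagon centerA.eval (3 - 2 * √2) := by
  refine ⟨shrinkRatio_pos, [.A], List.replicate 7 .A, by simp, ?_, ?_⟩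
  · have := congrArg CycInt.eval centerA_fixed
    rwa [CycInt.eval_add, CycInt.eval_rotatePow] at this
  · rw [← polygon_octagonSides (r := (-2, 2)), ← polygon_cylinderSides_A]
    · rfl
    · simp only [quadReal]
      push_cast
      linear_combination 4 * sqrt_two_mul_self

theorem isReturningOctagon_D : IsReturningOctagon centerD.eval ((3 - 2 * √2) ^ 2) := by
  refine ⟨pow_pos shrinkRatio_pos 2, [.A, .A, .B, .A, .A],
    (List.replicate 7 [.A, .A, .B, .A, .A]).flatten, by simp, ?_, ?_⟩
  · have := congrArg CycInt.eval centerD_fixed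
    rwa [CycInt.eval_add, CycInt.eval_rotatePow] at this
  · rw [← polygon_octagonSides (r := (-14, 10)), ← polygon_cylinderSides_D]
    · rfl
    · simp only [quadReal]
      push_cast
      linear_combination (-8 * √2 + 16) * sqrt_two_mul_self

theorem IsReturningOctagon.shrinkMap {c : ℂ} {τ : ℝ} (h : IsReturningOctagon c τ) :
    IsReturningOctagon (shrinkMap c) ((3 - 2 * √2) * τ) := by
  obtain ⟨hτ, w, w', hw, hc, hcyl⟩ := h
  obtain ⟨i, v, rfl⟩ := List.exists_cons_of_ne_nil hw
  obtain ⟨r, hr⟩ := exists_subst_eq i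
  obtain ⟨h1, h2⟩ := cylinder_shrink hc hcyl
  exact ⟨mul_pos shrinkRatio_pos hτ, _, _, by rw [List.flatMap_cons, hr]; simp, h1, h2⟩

/-! ### Triangles -/

/-- Twice the signed area of the triangle with vertices `x`, `y`, `z`. -/
def doubleArea (x y z : ℂ) : ℝ :=
  (y.re - x.re) * (z.im - x.im) - (y.im - x.im) * (z.re - x.re)

theorem mem_interior_triangle {x y z c : ℂ} (hx : 0 < doubleArea y z c)
    (hy : 0 < doubleArea z x c) (hz : 0 < doubleArea x y c) : c ∈ interior (triangle x y z) := by
  have hopen : IsOpen {w | 0 < doubleArea y z w ∧ 0 < doubleArea z x w ∧ 0 < doubleArea x y w} := by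
    have : ∀ a b : ℂ, IsOpen {w | 0 < doubleArea a b w} := fun a b =>
      isOpen_lt continuous_const (by unfold doubleArea; fun_prop)
    exact (this _ _).inter ((this _ _).inter (this _ _))
  refine mem_interior.2 ⟨_, ?_, hopen, ⟨hx, hy, hz⟩⟩
  rintro w ⟨hx, hy, hz⟩
  have hconv : Convex ℝ (triangle x y z) := convex_convexHull ℝ _
  -- the barycentric coordinates of `w` are ratios of areas
  have hD : 0 < doubleArea y z w + doubleArea z x w + doubleArea x y w := by positivity
  have hmem : ∀ i ∈ Finset.univ, (![x, y, z] : Fin 3 → ℂ) i ∈ triangle x y z := by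
    intro i _
    apply subset_convexHull
    fin_cases i <;> simp
  have := hconv.sum_mem (t := Finset.univ)
    (w := ![doubleArea y z w / (doubleArea y z w + doubleArea z x w + doubleArea x y w),
      doubleArea z x w / (doubleArea y z w + doubleArea z x w + doubleArea x y w),
      doubleArea x y w / (doubleArea y z w + doubleArea z x w + doubleArea x y w)])
    (z := ![x, y, z])
    (by intro i _; fin_cases i <;> simp <;> positivity)
    (by simp [Fin.sum_univ_three]; field_simp) hmem
  convert this using 1
  simp only [Fin.sum_univ_three, Matrix.cons_val_zero, Matrix.cons_val_one, Matrix.cons_val]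
  apply Complex.ext
  · simp only [Complex.add_re, Complex.real_smul, Complex.re_ofReal_mul]
    field_simp
    unfold doubleArea
    ring
  · simp only [Complex.add_im, Complex.real_smul, Complex.im_ofReal_mul]
    field_simp
    unfold doubleArea
    ring

theorem limitPoint_mem_interior_triangle :
    limitPoint ∈ interior (triangle centerA.eval (shrinkMap centerD.eval) centerD.eval) := by
  have hs := sqrt_two_mul_self
  have hb := sqrt_two_bounds
  have hA : centerA.eval = ⟨0, 2 * √2⟩ := by
    simp only [centerA, CycInt.eval, zeta_sq, zeta_pow_three]
    apply Complex.ext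
    · simp [zeta]
    · simp [zeta]; ring
  have hD : centerD.eval = ⟨6 - 4 * √2, 6 * √2 - 6⟩ := by
    simp only [centerD, CycInt.eval, zeta_sq, zeta_pow_three]
    apply Complex.ext
    · simp [zeta]; ring
    · simp [zeta]; ring
  have hS : shrinkMap centerD.eval = ⟨36 - 26 * √2, 30 * √2 - 40⟩ := by
    rw [hD, shrinkMap, shrinkShift_eval]
    apply Complex.ext
    · simp [apex]; linear_combination 8 * hs
    · simp [apex]; linear_combination (-10) * hs
  rw [hS, hA, hD]
  apply mem_interior_triangle <;> simp only [doubleArea, limitPoint] <;> nlinarith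

/-! ### The octagons around the limit point -/

theorem limitPoint_notMem_openOctagon : limitPoint ∉ openOctagon centerA.eval (3 - 2 * √2) := by
  intro h
  have hA : limitPoint ∈ polygon (Piece.sides .A) := by
    rw [← polygon_octagonSides (r := (-2, 2)), ← polygon_cylinderSides_A] at h
    · exact (mem_cylinder_cons.1 h).1
    · simp only [quadReal]
      push_cast
      linear_combination 4 * sqrt_two_mul_self
  -- the pieces `A` and `B` lie on different sides of a line
  have h3 := hA ⟨3, (-6, 2)⟩ (by simp [Piece.sides])
  have h7 := limitPoint_mem_piece ⟨7, (6, -2)⟩ (by simp [Piece.sides])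
  simp only [HalfPlane.Contains, quadReal, show (7 : ℕ) = 3 + 4 from rfl, pow_add,
    zeta_pow_four, mul_neg, mul_one, Complex.neg_re] at h3 h7
  push_cast at h3 h7
  linarith

/-- The homothety with centre `limitPoint` that maps the sequence of octagons to itself. -/
noncomputable def homothetyPow (n : ℕ) (z : ℂ) : ℂ :=
  limitPoint + (ratio : ℂ) ^ n * (z - limitPoint)

theorem homothetyPow_eq_similarity (n : ℕ) :
    homothetyPow n =
      similarity (limitPoint - ((ratio ^ n : ℝ) : ℂ) * limitPoint) ((ratio ^ n : ℝ) : ℂ) := by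
  ext z
  simp only [homothetyPow, similarity]
  push_cast
  ring

theorem homothetyPow_limitPoint (n : ℕ) : homothetyPow n limitPoint = limitPoint := by
  simp [homothetyPow]

theorem limitPoint_mem_openOctagon_homothety {n : ℕ} {c : ℂ} {τ : ℝ} :
    limitPoint ∈ openOctagon (homothetyPow n c) (ratio ^ n * τ) ↔ limitPoint ∈ openOctagon c τ := by
  refine forall_congr' fun k => ?_
  have hn := pow_pos ratio_pos n
  rw [show (limitPoint - homothetyPow n c) * zeta ^ k =
    ((ratio ^ n : ℝ) : ℂ) * ((limitPoint - c) * zeta ^ k) by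
      simp only [homothetyPow]; push_cast; ring,
    Complex.re_ofReal_mul, ← mul_lt_mul_iff_right₀ hn (b := 2 * ((limitPoint - c) * zeta ^ k).re)]
  constructor <;> intro <;> linarith

/-- The centres of the first three octagons of the sequence, chosen so that their triangle contains
the limit point. -/
noncomputable def initialCenter (i : ℕ) : ℂ :=
  if i = 0 then centerA.eval else if i = 1 then shrinkMap centerD.eval else centerD.eval

/-- The ratios of the first three octagons of the sequence to the table. -/
noncomputable def initialRatio (i : ℕ) : ℝ :=
  if i = 0 then 3 - 2 * √2
  else if i = 1 then (3 - 2 * √2) * (3 - 2 * √2) ^ 2 else (3 - 2 * √2) ^ 2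

theorem isReturningOctagon_initial (i : ℕ) :
    IsReturningOctagon (initialCenter i) (initialRatio i) := by
  unfold initialCenter initialRatio
  split_ifs
  · exact isReturningOctagon_A
  · exact isReturningOctagon_D.shrinkMap
  · exact isReturningOctagon_D

/-- The centres of the self-similar sequence of octagons. -/
noncomputable def octagonCenter (n : ℕ) : ℂ := homothetyPow (n / 3) (initialCenter (n % 3))

/-- The ratios of the octagons of the self-similar sequence to the table. -/
noncomputable def octagonRatio (n : ℕ) : ℝ := ratio ^ (n / 3) * initialRatio (n % 3)

theorem isReturningOctagon (n : ℕ) : IsReturningOctagon (octagonCenter n) (octagonRatio n) :=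
  (isReturningOctagon_initial _).homothety _

theorem octagonRatio_pos (n : ℕ) : 0 < octagonRatio n := (isReturningOctagon n).1

theorem octagonCenter_add_three (n : ℕ) :
    octagonCenter (n + 3) = limitPoint + (ratio : ℂ) * (octagonCenter n - limitPoint) := by
  simp only [octagonCenter, homothetyPow, Nat.add_mod_right,
    Nat.add_div_right n (show 0 < 3 by norm_num)]
  ring

theorem octagonRatio_add_three (n : ℕ) : octagonRatio (n + 3) = ratio * octagonRatio n := by
  simp only [octagonRatio, Nat.add_mod_right, Nat.add_div_right n (show 0 < 3 by norm_num)]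
  ring

theorem octagonCenter_mul_three_add (k : ℕ) {i : ℕ} (hi : i < 3) :
    octagonCenter (3 * k + i) = homothetyPow k (initialCenter i) := by
  rw [octagonCenter, show (3 * k + i) / 3 = k by omega, show (3 * k + i) % 3 = i by omega]

theorem tendsto_ratio_pow_mul (f : ℕ → ℝ) :
    Tendsto (fun n => ratio ^ (n / 3) * f (n % 3)) atTop (𝓝 0) := by
  have h3 : Tendsto (fun n : ℕ => n / 3) atTop atTop :=
    Nat.tendsto_div_const_atTop (by norm_num)
  have h1 : Tendsto (fun n : ℕ => ratio ^ (n / 3)) atTop (𝓝 0) :=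
    (tendsto_pow_atTop_nhds_zero_of_lt_one ratio_pos.le ratio_lt_one).comp h3
  refine h1.zero_mul_isBoundedUnder_le ?_
  refine ⟨|f 0| + |f 1| + |f 2|, ?_⟩
  simp only [eventually_map, Function.comp, Real.norm_eq_abs]
  refine Eventually.of_forall fun n => ?_
  have hn : n % 3 < 3 := Nat.mod_lt _ (by norm_num)
  have := abs_nonneg (f 0)
  have := abs_nonneg (f 1)
  have := abs_nonneg (f 2)
  interval_cases n % 3 <;> linarith

theorem tendsto_octagonRatio : Tendsto octagonRatio atTop (𝓝 0) :=
  tendsto_ratio_pow_mul initialRatio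

theorem tendsto_octagonCenter : Tendsto octagonCenter atTop (𝓝 limitPoint) := by
  rw [tendsto_iff_norm_sub_tendsto_zero]
  convert tendsto_ratio_pow_mul (fun i => ‖initialCenter i - limitPoint‖) using 2 with n
  rw [octagonCenter, homothetyPow, add_sub_cancel_left, norm_mul, norm_pow, Complex.norm_real,
    Real.norm_of_nonneg ratio_pos.le]

/-- A periodic limit point would have a neighbourhood of periodic points, hence within one
component; but the octagons that come close to it do not contain it. -/
theorem not_isPeriodicPoint_limitPoint : ¬ IsPeriodicPoint table limitPoint := by
  intro h
  obtain ⟨m, hm, hper⟩ := isPeriodicPoint_iff.1 h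
  have h2 : billiardIter table (m + m) limitPoint = some limitPoint := by
    rw [billiardIter_add hper, hper]
  have hout : ∀ᶠ z in 𝓝 limitPoint, z ∉ table := by
    have hW := polygon_triangleSides_subset (polygon_sides_subset _ limitPoint_mem_piece)
    rw [polygon_wedgeSides] at hW
    filter_upwards [isOpen_wedge.mem_nhds hW] with z hz
    exact (isRightTangency_apex_iff.2 hz).1
  obtain ⟨ε, hε, hball⟩ := Metric.eventually_nhds_iff_ball.1
    ((eventually_billiardIter h2).and hout)
  have hF : Metric.ball limitPoint ε ⊆ nonfinitePoints table := by
    intro z hz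
    obtain ⟨hz1, hz2⟩ := hball z hz
    refine mem_nonfinitePoints_of_periodic hz2 (show 0 < m + m by omega) ?_
    rw [hz1, (Even.add_self m).neg_one_pow]
    congr 1
    ring
  have hlim : Tendsto (fun k => octagonCenter (3 * k)) atTop (𝓝 limitPoint) :=
    tendsto_octagonCenter.comp (tendsto_id.const_mul_atTop' (by norm_num))
  obtain ⟨k, hk⟩ := (hlim.eventually (Metric.ball_mem_nhds _ hε)).exists
  have hsub := subset_openOctagon (isReturningOctagon (3 * k))
    (convex_ball limitPoint ε).isPreconnected hF
    ⟨_, hk, center_mem_openOctagon _ (octagonRatio_pos _)⟩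
  have := hsub (Metric.mem_ball_self hε)
  rw [octagonCenter, octagonRatio, show 3 * k / 3 = k by omega, show 3 * k % 3 = 0 by omega,
    limitPoint_mem_openOctagon_homothety] at this
  exact limitPoint_notMem_openOctagon this

/-- The iterate `2 m` moves all points near the limit point by the same vector. This vector is not
zero, since the limit point is aperiodic; so no point near it has period `m`. -/
theorem tendsto_period {p : ℕ → ℕ} (hp : ∀ n, ∀ x ∈ openOctagon (octagonCenter n) (octagonRatio n),
    x ≠ octagonCenter n → HasPeriod table x (p n)) : Tendsto p atTop atTop := by
  let x : ℕ → ℂ := fun n => octagonCenter n + ((octagonRatio n / 2 : ℝ) : ℂ)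
  have hx : ∀ n, HasPeriod table (x n) (p n) := by
    intro n
    have hpos := octagonRatio_pos n
    refine hp n _ (fun k => ?_) ?_
    · have h1 : ‖zeta ^ k‖ = 1 := by
        rw [norm_pow, Complex.norm_eq_one_of_pow_eq_one zeta_pow_eight (by norm_num), one_pow]
      have h2 := (Complex.re_le_norm (zeta ^ k)).trans_eq h1
      simp only [x]
      rw [add_sub_cancel_left, Complex.re_ofReal_mul]
      nlinarith [sqrt_two_bounds.1]
    · simp only [x, ne_eq, add_eq_left, Complex.ofReal_eq_zero]
      positivity
  have hlim : Tendsto x atTop (𝓝 limitPoint) := by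
    have h1 : Tendsto (fun n => ((octagonRatio n / 2 : ℝ) : ℂ)) atTop (𝓝 0) := by
      have := (Complex.continuous_ofReal.tendsto _).comp (tendsto_octagonRatio.div_const 2)
      simpa [Function.comp_def] using this
    have := tendsto_octagonCenter.add h1
    rwa [add_zero] at this
  have hne : ∀ m, ∀ᶠ n in atTop, p n ≠ m := by
    intro m
    obtain ⟨u, hu⟩ := Option.ne_none_iff_exists'.1
      ((mem_nonfinitePoints.1 limitPoint_mem_nonfinitePoints).2 (m + m))
    filter_upwards [hlim.eventually (eventually_billiardIter hu)] with n hn hpm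
    obtain ⟨⟨hm, hxm⟩, -⟩ := hx n
    rw [hpm] at hm hxm
    rw [billiardIter_add hxm, hxm, Option.some_inj, (Even.add_self m).neg_one_pow] at hn
    have hul : u = limitPoint := by linear_combination -hn
    rw [hul] at hu
    exact not_isPeriodicPoint_limitPoint (isPeriodicPoint_iff.2 ⟨m + m, by omega, hu⟩)
  rw [tendsto_atTop]
  intro M
  filter_upwards [(eventually_all_finset (Finset.range M)).2 fun m _ => hne m] with n hn
  by_contra! hlt
  exact hn (p n) (Finset.mem_range.2 hlt) rfl

theorem limitPoint_mem_interior (k : ℕ) : limitPoint ∈ interior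
    (triangle (octagonCenter (3 * k)) (octagonCenter (3 * k + 1)) (octagonCenter (3 * k + 2))) := by
  have hb : ((ratio ^ k : ℝ) : ℂ) ≠ 0 := by exact_mod_cast (pow_pos ratio_pos k).ne'
  rw [octagonCenter_mul_three_add k (i := 1) (by norm_num),
    octagonCenter_mul_three_add k (i := 2) (by norm_num), ← add_zero (3 * k),
    octagonCenter_mul_three_add k (i := 0) (by norm_num), homothetyPow_eq_similarity,
    ← triangle_similarity, ← coe_similarityHomeomorph _ hb, ← Homeomorph.image_interior]
  refine ⟨limitPoint, limitPoint_mem_interior_triangle, ?_⟩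
  rw [coe_similarityHomeomorph, ← homothetyPow_eq_similarity, homothetyPow_limitPoint]

theorem triangle_subset_interior (k : ℕ) :
    triangle (octagonCenter (3 * k + 3)) (octagonCenter (3 * k + 4)) (octagonCenter (3 * k + 5)) ⊆
      interior (triangle (octagonCenter (3 * k)) (octagonCenter (3 * k + 1))
        (octagonCenter (3 * k + 2))) := by
  have hmem := limitPoint_mem_interior k
  have h : ∀ n, octagonCenter (n + 3) =
      similarity (limitPoint - (ratio : ℂ) * limitPoint) ratio (octagonCenter n) := by
    intro n
    rw [octagonCenter_add_three, similarity]
    ring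
  rw [h, show 3 * k + 4 = 3 * k + 1 + 3 from rfl, h, show 3 * k + 5 = 3 * k + 2 + 3 from rfl, h,
    ← triangle_similarity]
  rintro _ ⟨z, hz, rfl⟩
  have hconv : Convex ℝ (triangle (octagonCenter (3 * k)) (octagonCenter (3 * k + 1))
    (octagonCenter (3 * k + 2))) := convex_convexHull ℝ _
  have := hconv.combo_interior_self_mem_interior hmem hz (sub_pos.2 ratio_lt_one) ratio_pos.le
    (by ring)
  convert this using 1
  simp only [similarity, Complex.real_smul]
  push_cast
  ring

/-! ### The theorem for an arbitrary regular octagon -/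

theorem mainTheorem1 (o w : ℂ) (hw : w ≠ 0) :
    ∃ (C : ℂ) (c v : ℕ → ℂ) (p : ℕ → ℕ) (a : ℂ),
      -- `C` has an infinite aperiodic orbit
      IsAperiodicPoint (regularOctagon o w) C ∧
      (billiardOrbit (regularOctagon o w) C).Infinite ∧
      -- the interior of the octagon with centre `c n` is a periodic component of period `p n`
      (∀ n, v n ≠ 0 ∧
        IsBilliardComponent (regularOctagon o w) (interior (regularOctagon (c n) (v n))) ∧
        ∀ x ∈ interior (regularOctagon (c n) (v n)),
          IsPeriodicPoint (regularOctagon o w) x ∧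
          (x ≠ c n → HasPeriod (regularOctagon o w) x (p n))) ∧
      -- the periods grow without bound
      Tendsto p atTop atTop ∧
      -- the sequence is self-similar and converges to `C`
      a ≠ 0 ∧ ‖a‖ < 1 ∧
      (∀ n, c (n + 3) = C + a * (c n - C) ∧
        regularOctagon (c (n + 3)) (v (n + 3)) =
          (fun z => C + a * (z - C)) '' regularOctagon (c n) (v n)) ∧
      Tendsto c atTop (𝓝 C) ∧
      -- the triangles of consecutive centres are nested around `C`
      (∀ k, C ∈ interior (triangle (c (3 * k)) (c (3 * k + 1)) (c (3 * k + 2))) ∧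
        triangle (c (3 * k + 3)) (c (3 * k + 4)) (c (3 * k + 5)) ⊆
          interior (triangle (c (3 * k)) (c (3 * k + 1)) (c (3 * k + 2)))) := by
  obtain ⟨b, hb, rfl⟩ : ∃ b : ℂ, b ≠ 0 ∧ w = b * apex :=
    ⟨w / apex, div_ne_zero hw apex_ne_zero, (div_mul_cancel₀ w apex_ne_zero).symm⟩
  have hK : regularOctagon o (b * apex) = similarity o b '' table := by
    rw [table, regularOctagon_similarity, mul_zero, add_zero]
  have hU : ∀ n, interior (regularOctagon (similarity o b (octagonCenter n))
      (b * (octagonRatio n * apex))) =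
      similarity o b '' openOctagon (octagonCenter n) (octagonRatio n) := by
    intro n
    rw [similarity, ← regularOctagon_similarity, ← coe_similarityHomeomorph o hb,
      ← Homeomorph.image_interior, interior_regularOctagon _ (octagonRatio_pos n)]
  have hT : ∀ x y z, interior (triangle (similarity o b x) (similarity o b y) (similarity o b z)) =
      similarity o b '' interior (triangle x y z) := by
    intro x y z
    rw [← triangle_similarity, ← coe_similarityHomeomorph o hb, ← Homeomorph.image_interior]
  choose p hp using fun n => exists_hasPeriod (isReturningOctagon n)
  have hC : IsAperiodicPoint (similarity o b '' table) (similarity o b limitPoint) :=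
    (isAperiodicPoint_similarity hb).2 (isAperiodicPoint_iff.2
      ⟨limitPoint_mem_nonfinitePoints, not_isPeriodicPoint_limitPoint⟩)
  have hcenter : ∀ n, similarity o b (octagonCenter (n + 3)) = similarity o b limitPoint +
      ratio * (similarity o b (octagonCenter n) - similarity o b limitPoint) := by
    intro n
    rw [octagonCenter_add_three]
    simp only [similarity]
    ring
  refine ⟨similarity o b limitPoint, fun n => similarity o b (octagonCenter n),
    fun n => b * (octagonRatio n * apex), p, ratio, ?_⟩
  rw [hK]
  refine ⟨hC, hC.infinite_billiardOrbit, fun n => ⟨?_, ?_, ?_⟩,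
    tendsto_period fun n x hx => (hp n x hx).2, ?_, ?_, fun n => ⟨hcenter n, ?_⟩, ?_,
    fun k => ⟨?_, ?_⟩⟩
  · have : (octagonRatio n : ℂ) ≠ 0 := by exact_mod_cast (octagonRatio_pos n).ne'
    exact mul_ne_zero hb (mul_ne_zero this apex_ne_zero)
  · rw [hU]
    exact isBilliardComponent_similarity hb (isBilliardComponent_openOctagon (isReturningOctagon n))
  · rw [hU]
    rintro _ ⟨x, hx, rfl⟩
    obtain ⟨h1, h2⟩ := hp n x hx
    exact ⟨(isPeriodicPoint_similarity hb).2 h1, fun hne =>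
      (hasPeriod_similarity hb).2 (h2 fun e => hne (by rw [e]))⟩
  · exact_mod_cast ratio_pos.ne'
  · rw [Complex.norm_real, Real.norm_of_nonneg ratio_pos.le]
    exact ratio_lt_one
  · have e : (fun z => similarity o b limitPoint + (ratio : ℂ) * (z - similarity o b limitPoint)) =
        similarity (similarity o b limitPoint - ratio * similarity o b limitPoint) ratio := by
      ext z
      simp only [similarity]
      ring
    rw [e, regularOctagon_similarity]
    dsimp only
    rw [hcenter, octagonRatio_add_three]
    congr 1
    · ring
    · push_cast; ring
  · exact ((similarityHomeomorph o hb).continuous.tendsto _).comp tendsto_octagonCenter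
  · rw [hT]
    exact Set.mem_image_of_mem _ (limitPoint_mem_interior k)
  · rw [hT, ← triangle_similarity]
    exact Set.image_mono (triangle_subset_interior k)
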